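/- Let $B \xrightarrow{f} A \xleftarrow{g} C$ be maps of quasi-categories. Let $f\downarrow g$ be the simplicial set defined as the pullback of the map $A^{\Delta^1}\to A\times A$, (target, source), along $g\times f\colon C\times B\to A\times A$, with projections $p_0\colon f\downarrow g\to B$ and $p_1\colon f\downarrow g\to C$. Let $h$ denote the functor sending a simplicial set to its homotopy category, and let $\mathrm{qCat}_2$ be the 2-category whose objects are quasi-categories and whose hom-categories are $\hom'(X,Y)=h(Y^X)$. Call a functor between categories smothering if it is surjective on objects, full, and conservative (reflects isomorphisms). Then: (1) $f\downarrow g$ is a quasi-category. (2) $f\downarrow g$ is a weak comma object of $f$ and $g$ in $\mathrm{qCat}_2$: let $\psi\colon f p_0\Rightarrow g p_1$ be the 2-cell of $\mathrm{qCat}_2$ represented by the map $(f\downarrow g)\times\Delta^1\to A$ adjoint to the projection $f\downarrow g\to A^{\Delta^1}$; then for every quasi-category $X$ the functor $$\hom'(X,f\downarrow g)\longrightarrow \hom'(X,f)\downarrow\hom'(X,g)$$ to the comma category of $\hom'(X,f)\colon\hom'(X,B)\to\hom'(X,A)$ and $\hom'(X,g)\colon\hom'(X,C)\to\hom'(X,A)$,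 induced by composition with the cone $(p_0,p_1,\psi)$, is smothering. (3) The canonical comparison functor $h(f\downarrow g)\to h(f)\downarrow h(g)$ to the comma category of $h(f)\colon hB\to hA$ and $h(g)\colon hC\to hA$ is smothering. -/

import Mathlib

universe u v w

open CategoryTheory MonoidalCategory CartesianMonoidalCategory Simplicial Opposite

noncomputable section

namespace WeakComma

/-- A functor is smothering if it is surjective on objects, full and conservative. -/
structure IsSmothering {C D : Type*} [Category* C] [Category* D] (F : C ⥤ D) : Prop where
  surjective_obj : Function.Surjective F.obj
  full : F.Full
  conservative : F.ReflectsIsomorphisms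

section Bicategory

open Bicategory

variable {𝒞 : Type u} [Bicategory.{w, v} 𝒞] {A B C : 𝒞}

/-- A comma cone with summit `P` over `B --f--> A <--g-- C`: 1-cells `p₀ : P ⟶ B`, `p₁ : P ⟶ C`
and a 2-cell `ψ` from `f p₀` to `g p₁`. -/
structure CommaCone (f : B ⟶ A) (g : C ⟶ A) (P : 𝒞) where
  p₀ : P ⟶ B
  p₁ : P ⟶ C
  ψ : p₀ ≫ f ⟶ p₁ ≫ g

/-- The functor `𝒞(K, P) ⥤ 𝒞(K, f) ↓ 𝒞(K, g)` induced by composition with a comma cone. -/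
def CommaCone.comparison {f : B ⟶ A} {g : C ⟶ A} {P : 𝒞} (c : CommaCone f g P) (K : 𝒞) :
    (K ⟶ P) ⥤ Comma (postcomp K f) (postcomp K g) where
  obj a :=
    { left := a ≫ c.p₀
      right := a ≫ c.p₁
      hom := (α_ a c.p₀ f).hom ≫ a ◁ c.ψ ≫ (α_ a c.p₁ g).inv }
  map {a a'} τ :=
    { left := τ ▷ c.p₀
      right := τ ▷ c.p₁
      w := by
        change τ ▷ c.p₀ ▷ f ≫ (α_ a' c.p₀ f).hom ≫ a' ◁ c.ψ ≫ (α_ a' c.p₁ g).inv =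
          ((α_ a c.p₀ f).hom ≫ a ◁ c.ψ ≫ (α_ a c.p₁ g).inv) ≫ τ ▷ c.p₁ ▷ g
        simp only [Category.assoc, ← Bicategory.associator_inv_naturality_left,
          Bicategory.whisker_exchange_assoc, Bicategory.associator_naturality_left_assoc] }

/-- A comma cone displays its summit as a weak comma object if the induced comparison functors
out of all hom-categories `𝒞(K, P)` are smothering. -/
def CommaCone.IsWeakComma {f : B ⟶ A} {g : C ⟶ A} {P : 𝒞} (c : CommaCone f g P) : Prop :=
  ∀ K : 𝒞, IsSmothering (c.comparison K)

end Bicategory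

/-! ### The comma simplicial set -/

/-- The simplicial set `A^{Δ¹}`. -/
abbrev arrows (A : SSet.{u}) : SSet.{u} := (ihom (Δ[1] : SSet.{u})).obj A

/-- Restriction `A^{Δ¹} ⟶ A` along the vertex `i` of `Δ¹`. -/
def evVertex (A : SSet.{u}) (i : Fin 2) : arrows A ⟶ A :=
  lift (SSet.const (SSet.stdSimplex.obj₀Equiv.{u}.symm i)) (𝟙 _) ≫ (ihom.ev Δ[1]).app A

variable {A B C : SSet.{u}} (f : B ⟶ A) (g : C ⟶ A)

/-- The comma simplicial set `f ↓ g`: the pullback of `(target, source) : A^{Δ¹} ⟶ A × A`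
along `g × f : C × B ⟶ A × A`. -/
def commaObj : SSet.{u} :=
  Limits.pullback (g ⊗ₘ f) (lift (evVertex A 1) (evVertex A 0))

/-- The projection `f ↓ g ⟶ C × B`. -/
def commaProj : commaObj f g ⟶ C ⊗ B := Limits.pullback.fst _ _

/-- The projection `f ↓ g ⟶ A^{Δ¹}`. -/
def commaArrow : commaObj f g ⟶ arrows A := Limits.pullback.snd _ _

/-- The projection `p₀ : f ↓ g ⟶ B`. -/
def commaP₀ : commaObj f g ⟶ B := commaProj f g ≫ snd C B

/-- The projection `p₁ : f ↓ g ⟶ C`. -/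
def commaP₁ : commaObj f g ⟶ C := commaProj f g ≫ fst C B

lemma commaArrow_source : commaArrow f g ≫ evVertex A 0 = commaP₀ f g ≫ f := by
  have h := Limits.pullback.condition (f := g ⊗ₘ f) (g := lift (evVertex A 1) (evVertex A 0))
  have := congr($h ≫ snd A A)
  simp only [Category.assoc, tensorHom_snd, lift_snd] at this
  rw [commaP₀, Category.assoc]
  exact this.symm

lemma commaArrow_target : commaArrow f g ≫ evVertex A 1 = commaP₁ f g ≫ g := by
  have h := Limits.pullback.condition (f := g ⊗ₘ f) (g := lift (evVertex A 1) (evVertex A 0))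
  have := congr($h ≫ fst A A)
  simp only [Category.assoc, tensorHom_fst, lift_fst] at this
  rw [commaP₁, Category.assoc]
  exact this.symm

/-- The simplicial map `(f ↓ g) × Δ¹ ⟶ A` that is adjoint to `f ↓ g ⟶ A^{Δ¹}`. -/
def commaHtpy : commaObj f g ⊗ Δ[1] ⟶ A :=
  (β_ _ _).hom ≫ Δ[1] ◁ commaArrow f g ≫ (ihom.ev Δ[1]).app A

lemma ι₀_commaHtpy : SSet.ι₀ ≫ commaHtpy f g = commaP₀ f g ≫ f := by
  rw [← commaArrow_source]
  rfl

lemma ι₁_commaHtpy : SSet.ι₁ ≫ commaHtpy f g = commaP₁ f g ≫ g := by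
  rw [← commaArrow_target]
  rfl

/-! ### The comparison functor between homotopy categories -/

/-- The simplex `(x, y)` of `X × Y`. -/
abbrev prodSimplex {X Y : SSet.{u}} {n : SimplexCategoryᵒᵖ} (x : X.obj n) (y : Y.obj n) :
    (X ⊗ Y).obj n := (x, y)

/-- The nondegenerate edge of `Δ¹`. -/
def edge01 : (Δ[1] : SSet.{u}) _⦋1⦌ := SSet.stdSimplex.objEquiv.symm (𝟙 _)

lemma δ_one_edge01 : (Δ[1] : SSet.{u}).δ 1 edge01 = SSet.stdSimplex.obj₀Equiv.{u}.symm 0 := by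
  ext i
  fin_cases i
  rfl

lemma δ_zero_edge01 : (Δ[1] : SSet.{u}).δ 0 edge01 = SSet.stdSimplex.obj₀Equiv.{u}.symm 1 := by
  ext i
  fin_cases i
  rfl

section

variable {X Y : SSet.{u}} {a b : X ⟶ Y} (H : X ⊗ Δ[1] ⟶ Y) (h₀ : SSet.ι₀ ≫ H = a)
  (h₁ : SSet.ι₁ ≫ H = b)

/-- The edge of `Y` from `a x` to `b x` which a homotopy `H : X × Δ¹ ⟶ Y` from `a` to `b`
associates with a vertex `x` of `X`. -/
def htpyEdge (x : X _⦋0⦌) :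
    SSet.Edge (a.app _ x) (b.app _ x) :=
  SSet.Edge.mk (H.app (op ⦋1⦌) (prodSimplex (X.σ 0 x) edge01))
    (by
      subst h₀
      refine (SSet.δ_naturality_apply H _ (prodSimplex (X.σ 0 x) edge01)).symm.trans ?_
      refine congrArg (H.app (op ⦋0⦌)) (Prod.ext ?_ ?_)
      · exact ConcreteCategory.congr_hom (X.δ_comp_σ_succ (i := (0 : Fin 1))) x
      · exact δ_one_edge01)
    (by
      subst h₁
      refine (SSet.δ_naturality_apply H _ (prodSimplex (X.σ 0 x) edge01)).symm.trans ?_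
      refine congrArg (H.app (op ⦋0⦌)) (Prod.ext ?_ ?_)
      · exact ConcreteCategory.congr_hom (X.δ_comp_σ_self (i := (0 : Fin 1))) x
      · exact δ_zero_edge01)

open SSet.Truncated.HomotopyCategory in
lemma htpyEdge_naturality {x y : X _⦋0⦌} (e : ((SSet.truncation 2).obj X).Edge x y) :
    homMk (e.map ((SSet.truncation 2).map a)) ≫ homMk (htpyEdge H h₀ h₁ y).toTruncated =
      homMk (htpyEdge H h₀ h₁ x).toTruncated ≫ homMk (e.map ((SSet.truncation 2).map b)) := by
  subst h₀ h₁
  have h := congrArg (SSet.Truncated.mapHomotopyCategory ((SSet.truncation 2).map H)).map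
    (BinaryProduct.square e (SSet.Edge.mk edge01 δ_one_edge01 δ_zero_edge01).toTruncated)
  exact (Functor.map_comp _ _ _).symm.trans (h.trans (Functor.map_comp _ _ _))

end

/-- The natural transformation `hf ∘ hp₀ ⟶ hg ∘ hp₁` whose component at a vertex `x` of `f ↓ g`
is the class of the edge of `A` to which `f ↓ g ⟶ A^{Δ¹}` sends `x`. -/
def hoCommaNat :
    (SSet.hoFunctor.map (commaP₀ f g)).toFunctor ⋙ (SSet.hoFunctor.map f).toFunctor ⟶
      (SSet.hoFunctor.map (commaP₁ f g)).toFunctor ⋙ (SSet.hoFunctor.map g).toFunctor :=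
  SSet.Truncated.HomotopyCategory.mkNatTrans
    (F := SSet.Truncated.mapHomotopyCategory ((SSet.truncation 2).map (commaP₀ f g)) ⋙
      SSet.Truncated.mapHomotopyCategory ((SSet.truncation 2).map f))
    (G := SSet.Truncated.mapHomotopyCategory ((SSet.truncation 2).map (commaP₁ f g)) ⋙
      SSet.Truncated.mapHomotopyCategory ((SSet.truncation 2).map g))
    (fun x ↦ SSet.Truncated.HomotopyCategory.homMk
      (htpyEdge (commaHtpy f g) (ι₀_commaHtpy f g) (ι₁_commaHtpy f g) x).toTruncated)
    (fun _ _ e ↦ htpyEdge_naturality (commaHtpy f g) (ι₀_commaHtpy f g) (ι₁_commaHtpy f g) e)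

/-- The comparison functor `h(f ↓ g) ⥤ hf ↓ hg`, induced by the functors `hp₀`, `hp₁` and the
natural transformation `hf ∘ hp₀ ⟶ hg ∘ hp₁` given by the map `(f ↓ g) × Δ¹ ⟶ A`. -/
def hoComparison : (SSet.hoFunctor.obj (commaObj f g)) ⥤
    Comma (SSet.hoFunctor.map f).toFunctor (SSet.hoFunctor.map g).toFunctor where
  obj x :=
    { left := (SSet.hoFunctor.map (commaP₀ f g)).toFunctor.obj x
      right := (SSet.hoFunctor.map (commaP₁ f g)).toFunctor.obj x
      hom := (hoCommaNat f g).app x }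
  map {x y} e :=
    { left := (SSet.hoFunctor.map (commaP₀ f g)).toFunctor.map e
      right := (SSet.hoFunctor.map (commaP₁ f g)).toFunctor.map e
      w := (hoCommaNat f g).naturality e }

/-! ### Edges of simplicial homs -/

section

variable {X Y : SSet.{u}} {a b : X ⟶ Y} (H : X ⊗ Δ[1] ⟶ Y) (h₀ : SSet.ι₀ ≫ H = a)
  (h₁ : SSet.ι₁ ≫ H = b)

/-- The 1-simplex of the simplicial hom `Y^X` given by a map `X × Δ¹ ⟶ Y`. -/
def htpySimplex (H : X ⊗ Δ[1] ⟶ Y) : (SimplicialCategory.sHom X Y) _⦋1⦌ :=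
  ({ app c φ := ↾fun x ↦ H.app c (prodSimplex x (SSet.stdSimplex.objEquiv.symm φ.unop))
     naturality := by
      intro c d φ a
      ext x
      exact H.naturality_apply φ (prodSimplex (X := X) (Y := Δ[1]) x
        (SSet.stdSimplex.objEquiv.symm a.unop)) } : Functor.HomObj X Y (coyoneda.obj (op (op ⦋1⦌))))

/-- The vertex of the simplicial hom `Y^X` given by a map `X ⟶ Y`. -/
def homVertex (a : X ⟶ Y) : (SimplicialCategory.sHom X Y) _⦋0⦌ :=
  SimplicialCategory.homEquiv' X Y a

/-- The edge of `Y^X` from `a` to `b` given by a homotopy `H : X × Δ¹ ⟶ Y` from `a` to `b`. -/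
def htpySimplexEdge : SSet.Edge (homVertex a) (homVertex b) :=
  SSet.Edge.mk (htpySimplex H)
    (by
      subst h₀
      refine Functor.HomObj.ext ?_
      funext c φ
      ext x
      refine congrArg (H.app c) (Prod.ext rfl ?_)
      exact congrArg ((Δ[1] : SSet.{u}).map φ) δ_one_edge01)
    (by
      subst h₁
      refine Functor.HomObj.ext ?_
      funext c φ
      ext x
      refine congrArg (H.app c) (Prod.ext rfl ?_)
      exact congrArg ((Δ[1] : SSet.{u}).map φ) δ_zero_edge01)

end

/-! ### The 2-category of quasi-categories -/

/-- The 2-category of quasi-categories, with hom-categories `h(Y^X)`: this is the strict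
bicategory `SSet.QCat.bicategory` of Mathlib. -/
def qCat₂ : Type (u + 1) := SSet.QCat.{u}

namespace qCat₂

instance : Bicategory qCat₂.{u} := SSet.QCat.bicategory
instance : Bicategory.Strict qCat₂.{u} := SSet.QCat.strictBicategory

/-- A quasi-category as an object of `qCat₂`. -/
def of (X : SSet.{u}) (hX : SSet.Quasicategory X) : qCat₂.{u} :=
  (ObjectProperty.FullSubcategory.mk X hX : SSet.QCat.{u})

variable {X Y : SSet.{u}} {hX : SSet.Quasicategory X} {hY : SSet.Quasicategory Y}

/-- A map of quasi-categories as a 1-cell of `qCat₂`. -/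
def ofMap (a : X ⟶ Y) : of X hX ⟶ of Y hY :=
  (ObjectProperty.homMk a : (ObjectProperty.FullSubcategory.mk X hX : SSet.QCat.{u}) ⟶
    (ObjectProperty.FullSubcategory.mk Y hY : SSet.QCat.{u}))

/-- The 2-cell of `qCat₂` represented by a map `H : X × Δ¹ ⟶ Y`, that is the class in `h(Y^X)` of
the corresponding 1-simplex of `Y^X`. -/
def ofHtpy {a b : X ⟶ Y} (H : X ⊗ Δ[1] ⟶ Y) (h₀ : SSet.ι₀ ≫ H = a) (h₁ : SSet.ι₁ ≫ H = b) :
    (ofMap a : of X hX ⟶ of Y hY) ⟶ ofMap b :=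
  CatEnrichedOrdinary.Hom.mk' (C := SSet.QCat.{u})
    (X := (ObjectProperty.FullSubcategory.mk X hX : SSet.QCat.{u}))
    (Y := (ObjectProperty.FullSubcategory.mk Y hY : SSet.QCat.{u}))
    (SSet.Truncated.HomotopyCategory.homMk (htpySimplexEdge H h₀ h₁).toTruncated)

end qCat₂

/-- The canonical comma cone in `qCat₂` with summit `f ↓ g`: its legs are the projections `p₀` and
`p₁`, and its 2-cell is represented by the map `(f ↓ g) × Δ¹ ⟶ A`. -/
def commaCone (hA : SSet.Quasicategory A) (hB : SSet.Quasicategory B) (hC : SSet.Quasicategory C)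
    (hP : SSet.Quasicategory (commaObj f g)) :
    CommaCone (qCat₂.ofMap f : qCat₂.of B hB ⟶ qCat₂.of A hA)
      (qCat₂.ofMap g : qCat₂.of C hC ⟶ qCat₂.of A hA) (qCat₂.of (commaObj f g) hP) where
  p₀ := qCat₂.ofMap (commaP₀ f g)
  p₁ := qCat₂.ofMap (commaP₁ f g)
  ψ := qCat₂.ofHtpy (commaHtpy f g) (ι₀_commaHtpy f g) (ι₁_commaHtpy f g)

end WeakComma

end

noncomputable section

namespace WeakComma

/-! ### Inner horns in low dimension -/

section Horns

variable {X : SSet.{u}}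

/-! A map S → f ↓ g is the same as maps b : S → B, c : S → C and a homotopy S × Δ¹ → A from f b to g
c (`IsComma`). This property passes to `K`-cotensors (`IsComma.pow`), so (2) and (3) both reduce to
facts about vertices and edges of a simplicial set P with this property.

Surjectivity: in a quasi-category every morphism of h is the class of an edge (`homMk_surjective`),
and an edge f b → g c is a vertex of P.

Fullness (`IsComma.exists_hom`): a square commuting in hA has both composites represented by one
edge d, hence consists of two honest 2-simplices with common diagonal d (`nonempty_compStruct`). One
triangle is an edge of P constant in B (a bottom cone), the other an edge constant in C (a top
cone). They meet at the vertex with arrow d, and their composite in hP is the required lift.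

Conservativity (`IsComma.isInvertible`): shearing the square splits any edge of P into a bottom cone
followed by a top cone. A bottom cone over an invertible edge of C has a right inverse of the same
kind, because the lifting problem in A is an inner 3-horn. Repeating this gives a right inverse
which itself has one, hence invertibility. Top cones are dual. Only inner horns are used.

For (1), A^{Δ¹} → A × A is an inner fibration, being restriction along the monomorphism of the two
endpoints into Δ¹. So its pullback f ↓ g → C × B is one too, over a quasi-category. -/

lemma δ_δ_eq {n : ℕ} {i k : Fin (n + 2)} {j l : Fin (n + 3)} (s : X _⦋n + 2⦌)
    (h : SimplexCategory.δ i ≫ SimplexCategory.δ j =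
      SimplexCategory.δ k ≫ SimplexCategory.δ l := by decide) :
    X.δ i (X.δ j s) = X.δ k (X.δ l s) := by
  have : ∀ (a : Fin (n + 2)) (b : Fin (n + 3)), X.δ a (X.δ b s) =
      X.map (SimplexCategory.δ a ≫ SimplexCategory.δ b).op s := fun a b ↦ by
    rw [op_comp, X.map_comp]; rfl
  rw [this, this, h]

variable [SSet.Quasicategory X]

lemma exists_simplex_of_horn₂₁ (e₀ e₂ : X _⦋1⦌) (h : X.δ 0 e₂ = X.δ 1 e₀) :
    ∃ s : X _⦋2⦌, X.δ 0 s = e₀ ∧ X.δ 2 s = e₂ := by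
  let φ : (Λ[2, 1] : SSet.{u}) ⟶ X := SSet.horn₂₁.isPushout.desc
    (SSet.yonedaEquiv.symm e₂) (SSet.yonedaEquiv.symm e₀) (by
      simp only [SSet.stdSimplex.δ_comp_yonedaEquiv_symm, h])
  obtain ⟨s, hs⟩ := SSet.Quasicategory.hornFilling (i := 1) (by decide) (by decide) φ
  have h₂ : SSet.horn₂₁.ι₀₁ ≫ φ = _ := SSet.horn₂₁.isPushout.inl_desc ..
  have h₀ : SSet.horn₂₁.ι₁₂ ≫ φ = _ := SSet.horn₂₁.isPushout.inr_desc ..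
  rw [hs, SSet.horn.ι_ι_assoc] at h₀ h₂
  refine ⟨SSet.yonedaEquiv s, ?_, ?_⟩
  · rw [← SSet.stdSimplex.yonedaEquiv_δ_comp, h₀, Equiv.apply_symm_apply]
  · rw [← SSet.stdSimplex.yonedaEquiv_δ_comp, h₂, Equiv.apply_symm_apply]

lemma exists_simplex_of_horn₃₁ (t₀ t₂ t₃ : X _⦋2⦌) (h₀₃ : X.δ 2 t₀ = X.δ 0 t₃)
    (h₀₂ : X.δ 1 t₀ = X.δ 0 t₂) (h₂₃ : X.δ 2 t₂ = X.δ 2 t₃) :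
    ∃ s : X _⦋3⦌, X.δ 0 s = t₀ ∧ X.δ 2 s = t₂ ∧ X.δ 3 s = t₃ := by
  obtain ⟨φ, h₀, h₂, h₃⟩ := SSet.horn₃₁.exists_desc (SSet.yonedaEquiv.symm t₀)
    (SSet.yonedaEquiv.symm t₂) (SSet.yonedaEquiv.symm t₃)
    (by simp only [SSet.stdSimplex.δ_comp_yonedaEquiv_symm, h₀₃])
    (by simp only [SSet.stdSimplex.δ_comp_yonedaEquiv_symm, h₀₂])
    (by simp only [SSet.stdSimplex.δ_comp_yonedaEquiv_symm, h₂₃])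
  obtain ⟨s, hs⟩ := SSet.Quasicategory.hornFilling (i := 1) (by decide) (by decide) φ
  rw [hs, SSet.horn.ι_ι_assoc] at h₀ h₂ h₃
  refine ⟨SSet.yonedaEquiv s, ?_, ?_, ?_⟩
  · rw [← SSet.stdSimplex.yonedaEquiv_δ_comp, h₀, Equiv.apply_symm_apply]
  · rw [← SSet.stdSimplex.yonedaEquiv_δ_comp, h₂, Equiv.apply_symm_apply]
  · rw [← SSet.stdSimplex.yonedaEquiv_δ_comp, h₃, Equiv.apply_symm_apply]

lemma exists_simplex_of_horn₃₂ (t₀ t₁ t₃ : X _⦋2⦌) (h₁₃ : X.δ 2 t₁ = X.δ 1 t₃)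
    (h₀₃ : X.δ 2 t₀ = X.δ 0 t₃) (h₀₁ : X.δ 0 t₀ = X.δ 0 t₁) :
    ∃ s : X _⦋3⦌, X.δ 0 s = t₀ ∧ X.δ 1 s = t₁ ∧ X.δ 3 s = t₃ := by
  obtain ⟨φ, h₀, h₁, h₃⟩ := SSet.horn₃₂.exists_desc (SSet.yonedaEquiv.symm t₀)
    (SSet.yonedaEquiv.symm t₁) (SSet.yonedaEquiv.symm t₃)
    (by simp only [SSet.stdSimplex.δ_comp_yonedaEquiv_symm, h₁₃])
    (by simp only [SSet.stdSimplex.δ_comp_yonedaEquiv_symm, h₀₃])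
    (by simp only [SSet.stdSimplex.δ_comp_yonedaEquiv_symm, h₀₁])
  obtain ⟨s, hs⟩ := SSet.Quasicategory.hornFilling (i := 2) (by decide) (by decide) φ
  rw [hs, SSet.horn.ι_ι_assoc] at h₀ h₁ h₃
  refine ⟨SSet.yonedaEquiv s, ?_, ?_, ?_⟩
  · rw [← SSet.stdSimplex.yonedaEquiv_δ_comp, h₀, Equiv.apply_symm_apply]
  · rw [← SSet.stdSimplex.yonedaEquiv_δ_comp, h₁, Equiv.apply_symm_apply]
  · rw [← SSet.stdSimplex.yonedaEquiv_δ_comp, h₃, Equiv.apply_symm_apply]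

/-- The homotopy category sees only the 2-truncation. There, a filler of an inner 3-horn survives as
its missing face. -/
instance : SSet.Truncated.Quasicategory₂ ((SSet.truncation 2).obj X) where
  fill21 {x₀ x₁ x₂} e₀₁ e₁₂ := by
    obtain ⟨s, h₀, h₂⟩ := exists_simplex_of_horn₂₁ (X := X) e₁₂.edge e₀₁.edge
      (e₀₁.tgt_eq.trans e₁₂.src_eq.symm)
    exact ⟨SSet.Edge.mk (X := X) (X.δ 1 s)
        ((δ_δ_eq s).trans ((congrArg (X.δ 1) h₂).trans e₀₁.src_eq))
        ((δ_δ_eq s).trans ((congrArg (X.δ 0) h₀).trans e₁₂.tgt_eq)),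
      ⟨s, h₂, h₀, rfl⟩⟩
  fill31 {x₀ x₁ x₂ x₃ e₀₁ e₁₂ e₂₃ e₀₂ e₁₃ e₀₃} f₃ f₀ f₂ := by
    obtain ⟨s, h₀, h₂, h₃⟩ := exists_simplex_of_horn₃₁ (X := X) f₀.simplex f₂.simplex f₃.simplex
      (f₀.d₂.trans f₃.d₀.symm) (f₀.d₁.trans f₂.d₀.symm) (f₂.d₂.trans f₃.d₂.symm)
    exact ⟨⟨X.δ 1 s, (δ_δ_eq s).trans ((congrArg (X.δ 1) h₃).trans f₃.d₁),
      (δ_δ_eq s).trans ((congrArg (X.δ 0) h₀).trans f₀.d₀),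
      (δ_δ_eq s).trans ((congrArg (X.δ 1) h₂).trans f₂.d₁)⟩⟩
  fill32 {x₀ x₁ x₂ x₃ e₀₁ e₁₂ e₂₃ e₀₂ e₁₃ e₀₃} f₃ f₀ f₁ := by
    obtain ⟨s, h₀, h₁, h₃⟩ := exists_simplex_of_horn₃₂ (X := X) f₀.simplex f₁.simplex f₃.simplex
      (f₁.d₂.trans f₃.d₁.symm) (f₀.d₂.trans f₃.d₀.symm) (f₀.d₀.trans f₁.d₀.symm)
    exact ⟨⟨X.δ 2 s, (δ_δ_eq s).trans ((congrArg (X.δ 2) h₃).trans f₃.d₂),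
      (δ_δ_eq s).trans ((congrArg (X.δ 1) h₀).trans f₀.d₁),
      (δ_δ_eq s).trans ((congrArg (X.δ 1) h₁).trans f₁.d₁)⟩⟩

end Horns

/-! ### The homotopy category of a quasi-category -/

section HomotopyCategory

open SSet.Truncated SSet.Truncated.HomotopyCategory SimplicialObject.Truncated

variable {V : SSet.Truncated.{u} 2} [Quasicategory₂ V]

instance : (morphismPropertyHomMk V).IsMultiplicative where
  id_mem x := by
    obtain ⟨x, rfl⟩ := x.mk_surjective
    rw [← homMk_id]
    exact morphismPropertyHomMk_of_edge _
  comp_mem := by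
    rintro _ _ _ _ _ ⟨x, y, e⟩ h
    obtain ⟨⟨y', z, e'⟩⟩ := h
    rw [homMk_comp_homMk (Edge.compStruct e e')]
    exact morphismPropertyHomMk_of_edge _

/-- Classes of edges generate the homotopy category, and filling inner 2-horns makes them closed
under composition. -/
lemma homMk_surjective {x y : V _⦋0⦌₂} (m : mk x ⟶ mk y) :
    ∃ e : Edge x y, homMk e = m := by
  have h : morphismPropertyHomMk V m := by
    rw [morphismProperty_eq_top morphismPropertyHomMk_of_edge]
    trivial
  obtain ⟨⟨_, _, e⟩⟩ := h
  exact ⟨e, rfl⟩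

variable (V) in
/-- The comparison functor to the category of homotopy classes of edges. -/
def toHomotopyCategory₂ : V.HomotopyCategory ⥤ HomotopyCategory₂ V :=
  lift (fun x ↦ HomotopyCategory₂.mk x) (fun e ↦ HomotopyCategory₂.homMk e) (fun _ ↦ rfl)
    (fun h ↦ h.homotopyCategory₂_fac)

lemma toHomotopyCategory₂_map_homMk {x y : V _⦋0⦌₂} (e : Edge x y) :
    (toHomotopyCategory₂ V).map (homMk e) = HomotopyCategory₂.homMk e :=
  lift_map_homMk ..

/-- A relation in the category presented by generators and relations is tested in the explicit
category of homotopy classes of edges, where it is witnessed by a 2-simplex. -/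
lemma nonempty_compStruct {x₀ x₁ x₂ : V _⦋0⦌₂} {e₀₁ : Edge x₀ x₁} {e₁₂ : Edge x₁ x₂}
    {e₀₂ : Edge x₀ x₂} (h : homMk e₀₁ ≫ homMk e₁₂ = homMk e₀₂) :
    Nonempty (Edge.CompStruct e₀₁ e₁₂ e₀₂) := by
  rw [Edge.CompStruct.nonempty_iff]
  have h' := congrArg (toHomotopyCategory₂ V).map h
  rw [Functor.map_comp] at h'
  exact (congrArg₂ (· ≫ ·) (toHomotopyCategory₂_map_homMk e₀₁).symm
    (toHomotopyCategory₂_map_homMk e₁₂).symm).trans (h'.trans (toHomotopyCategory₂_map_homMk e₀₂))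

end HomotopyCategory

/-! ### Maps out of prisms -/

section Prism

/-- The map `Δⁿ × Δ¹ ⟶ Δᵐ` given by a monotone map on vertices. -/
def prismMap {n m : ℕ} (φ : Fin (n + 1) × Fin 2 →o Fin (m + 1)) :
    (Δ[n] ⊗ Δ[1] : SSet.{u}) ⟶ Δ[m] where
  app k := ↾fun x ↦ SSet.stdSimplex.objEquiv.symm (SimplexCategory.Hom.mk (φ.comp
    (OrderHom.prod (SSet.stdSimplex.objEquiv x.1).toOrderHom
      (SSet.stdSimplex.objEquiv x.2).toOrderHom)))

/-- The monotone map contracting the bottom of the prism to the initial vertex. -/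
def bottomCollapse (n : ℕ) : Fin (n + 1) × Fin 2 →o Fin (n + 2) where
  toFun p := if p.2 = 0 then 0 else p.1.succ
  monotone' := by
    rintro ⟨i, j⟩ ⟨i', j'⟩ ⟨h, h'⟩
    dsimp at h h' ⊢
    split_ifs with h₁ h₂ h₂
    · rfl
    · exact Fin.zero_le _
    · grind
    · simpa using h

/-- The monotone map contracting the top of the prism to the final vertex. -/
def topCollapse (n : ℕ) : Fin (n + 1) × Fin 2 →o Fin (n + 2) where
  toFun p := if p.2 = 0 then p.1.castSucc else Fin.last _
  monotone' := by
    rintro ⟨i, j⟩ ⟨i', j'⟩ ⟨h, h'⟩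
    dsimp at h h' ⊢
    split_ifs with h₁ h₂ h₂
    · simpa using h
    · exact Fin.le_last _
    · grind
    · rfl

/-- The map `Δⁿ × Δ¹ ⟶ Δⁿ⁺¹` contracting the bottom of the prism to the initial vertex. -/
abbrev collapseBottom (n : ℕ) : (Δ[n] ⊗ Δ[1] : SSet.{u}) ⟶ Δ[n + 1] := prismMap (bottomCollapse n)

/-- The map `Δⁿ × Δ¹ ⟶ Δⁿ⁺¹` contracting the top of the prism to the final vertex. -/
abbrev collapseTop (n : ℕ) : (Δ[n] ⊗ Δ[1] : SSet.{u}) ⟶ Δ[n + 1] := prismMap (topCollapse n)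

lemma hom_stdSimplex_ext {X : SSet.{u}} {m : ℕ} {a b : X ⟶ Δ[m]}
    (h : ∀ (k : ℕ) (x : X _⦋k⦌) (i : Fin (k + 1)),
      (a.app _ x : (Δ[m] : SSet.{u}) _⦋k⦌) i = (b.app _ x : (Δ[m] : SSet.{u}) _⦋k⦌) i) : a = b := by
  ext ⟨⟨k⟩⟩ x i
  exact congrArg Fin.val (h k x i)

/-- The collapsed bottom is a new vertex placed first, so operators on Δⁿ act with their index
shifted by one. -/
lemma δ_whiskerRight_collapseBottom {n : ℕ} (i : Fin (n + 2)) :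
    SSet.stdSimplex.δ i ▷ _ ≫ collapseBottom.{u} (n + 1) =
      collapseBottom n ≫ SSet.stdSimplex.δ i.succ := by
  refine hom_stdSimplex_ext fun k ⟨x, y⟩ j ↦ ?_
  change (if y j = 0 then 0 else (i.succAbove (x j)).succ) =
    i.succ.succAbove (if y j = 0 then 0 else (x j).succ)
  split_ifs <;> simp

lemma σ_whiskerRight_collapseBottom {n : ℕ} (i : Fin (n + 1)) :
    SSet.stdSimplex.σ i ▷ _ ≫ collapseBottom.{u} n =
      collapseBottom (n + 1) ≫ SSet.stdSimplex.σ i.succ := by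
  refine hom_stdSimplex_ext fun k ⟨x, y⟩ j ↦ ?_
  change (if y j = 0 then 0 else (i.predAbove (x j)).succ) =
    i.succ.predAbove (if y j = 0 then 0 else (x j).succ)
  split_ifs <;> simp

lemma ι₀_collapseBottom (n : ℕ) :
    SSet.ι₀ ≫ collapseBottom.{u} n = SSet.const (SSet.stdSimplex.obj₀Equiv.{u}.symm 0) :=
  hom_stdSimplex_ext fun _ _ _ ↦ rfl

lemma ι₁_collapseBottom (n : ℕ) :
    SSet.ι₁ ≫ collapseBottom.{u} n = SSet.stdSimplex.δ 0 :=
  hom_stdSimplex_ext fun _ _ _ ↦ rfl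

/-- Here the new vertex comes last, so indices are not shifted. -/
lemma δ_whiskerRight_collapseTop {n : ℕ} (i : Fin (n + 2)) :
    SSet.stdSimplex.δ i ▷ _ ≫ collapseTop.{u} (n + 1) =
      collapseTop n ≫ SSet.stdSimplex.δ i.castSucc := by
  refine hom_stdSimplex_ext fun k ⟨x, y⟩ j ↦ ?_
  change (if y j = 0 then (i.succAbove (x j)).castSucc else Fin.last _) =
    i.castSucc.succAbove (if y j = 0 then (x j).castSucc else Fin.last _)
  split_ifs <;> simp

lemma σ_whiskerRight_collapseTop {n : ℕ} (i : Fin (n + 1)) :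
    SSet.stdSimplex.σ i ▷ _ ≫ collapseTop.{u} n =
      collapseTop (n + 1) ≫ SSet.stdSimplex.σ i.castSucc := by
  refine hom_stdSimplex_ext fun k ⟨x, y⟩ j ↦ ?_
  change (if y j = 0 then (i.predAbove (x j)).castSucc else Fin.last _) =
    i.castSucc.predAbove (if y j = 0 then (x j).castSucc else Fin.last _)
  split_ifs <;> simp

lemma ι₀_collapseTop (n : ℕ) :
    SSet.ι₀ ≫ collapseTop.{u} n = SSet.stdSimplex.δ (Fin.last _) := by
  refine hom_stdSimplex_ext fun k x j ↦ ?_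
  change (x j).castSucc = (Fin.last _).succAbove (x j)
  simp

lemma ι₁_collapseTop (n : ℕ) :
    SSet.ι₁ ≫ collapseTop.{u} n =
      SSet.const (SSet.stdSimplex.obj₀Equiv.{u}.symm (Fin.last _)) :=
  hom_stdSimplex_ext fun _ _ _ ↦ rfl

/-- In dimension 0 both collapses are Δ⁰ × Δ¹ ≅ Δ¹, so every vertex is a cone of both kinds. This
lets a bottom cone be followed by a top cone. -/
lemma collapseBottom_zero : collapseBottom.{u} 0 = snd _ _ := by
  refine hom_stdSimplex_ext fun k ⟨x, y⟩ j ↦ ?_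
  change (bottomCollapse 0) (x j, y j) = y j
  generalize x j = s; generalize y j = t
  revert s t; decide

lemma collapseTop_zero : collapseTop.{u} 0 = snd _ _ := by
  refine hom_stdSimplex_ext fun k ⟨x, y⟩ j ↦ ?_
  change (topCollapse 0) (x j, y j) = y j
  generalize x j = s; generalize y j = t
  revert s t; decide

/-- The first component, on vertices, of the map `shear`. -/
def shearMap : Fin 3 × Fin 2 →o Fin 2 where
  toFun p := if p.2 = 0 then Fin.predAbove 0 p.1 else Fin.predAbove 1 p.1
  monotone' := by decide

/-- The prism `Δ² × Δ¹ ⟶ Δ¹ × Δ¹` which exhibits the square as a composite of two squares, the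
first constant at the bottom and the second constant at the top. -/
def shear : (Δ[2] ⊗ Δ[1] : SSet.{u}) ⟶ Δ[1] ⊗ Δ[1] := lift (prismMap shearMap) (snd _ _)

lemma ι₀_shear : SSet.ι₀ ≫ shear.{u} = SSet.stdSimplex.σ 0 ≫ SSet.ι₀ := by
  ext1
  · exact hom_stdSimplex_ext fun _ _ _ ↦ rfl
  · rfl

lemma ι₁_shear : SSet.ι₁ ≫ shear.{u} = SSet.stdSimplex.σ 1 ≫ SSet.ι₁ := by
  ext1
  · exact hom_stdSimplex_ext fun _ _ _ ↦ rfl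
  · rfl

lemma δ_one_whiskerRight_shear : SSet.stdSimplex.δ 1 ▷ _ ≫ shear.{u} = 𝟙 _ := by
  ext1
  · refine hom_stdSimplex_ext fun k ⟨x, y⟩ j ↦ ?_
    change shearMap (Fin.succAbove 1 (x j), y j) = x j
    generalize x j = s; generalize y j = t
    revert s t; decide
  · rfl

lemma δ_two_whiskerRight_shear : SSet.stdSimplex.δ 2 ▷ _ ≫ shear.{u} =
    collapseBottom 1 ≫ lift (SSet.stdSimplex.σ 0) (SSet.stdSimplex.σ 1) := by
  ext1
  · refine hom_stdSimplex_ext fun k ⟨x, y⟩ j ↦ ?_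
    change shearMap (Fin.succAbove 2 (x j), y j) = Fin.predAbove 0 (bottomCollapse 1 (x j, y j))
    generalize x j = s; generalize y j = t
    revert s t; decide
  · refine hom_stdSimplex_ext fun k ⟨x, y⟩ j ↦ ?_
    change y j = Fin.predAbove 1 (bottomCollapse 1 (x j, y j))
    generalize x j = s; generalize y j = t
    revert s t; decide

lemma δ_zero_whiskerRight_shear : SSet.stdSimplex.δ 0 ▷ _ ≫ shear.{u} =
    collapseTop 1 ≫ lift (SSet.stdSimplex.σ 1) (SSet.stdSimplex.σ 0) := by
  ext1
  · refine hom_stdSimplex_ext fun k ⟨x, y⟩ j ↦ ?_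
    change shearMap (Fin.succAbove 0 (x j), y j) = Fin.predAbove 1 (topCollapse 1 (x j, y j))
    generalize x j = s; generalize y j = t
    revert s t; decide
  · refine hom_stdSimplex_ext fun k ⟨x, y⟩ j ↦ ?_
    change y j = Fin.predAbove 0 (topCollapse 1 (x j, y j))
    generalize x j = s; generalize y j = t
    revert s t; decide

end Prism

/-! ### Simplicial sets with the universal property of the comma simplicial set -/

section Cones

variable {A B C P : SSet.{u}}

/-- The universal property of the comma simplicial set: maps `S ⟶ P` correspond to triples of maps
`b : S ⟶ B`, `c : S ⟶ C` and `h : S × Δ¹ ⟶ A` such that `h` is a homotopy from `f b` to `g c`. -/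
structure IsComma (f : B ⟶ A) (g : C ⟶ A) (p₀ : P ⟶ B) (p₁ : P ⟶ C)
    (H : P ⊗ Δ[1] ⟶ A) : Prop where
  ι₀_comp : SSet.ι₀ ≫ H = p₀ ≫ f
  ι₁_comp : SSet.ι₁ ≫ H = p₁ ≫ g
  exists_lift {S : SSet.{u}} (b : S ⟶ B) (c : S ⟶ C) (h : S ⊗ Δ[1] ⟶ A)
    (h₀ : SSet.ι₀ ≫ h = b ≫ f) (h₁ : SSet.ι₁ ≫ h = c ≫ g) :
    ∃ s : S ⟶ P, s ≫ p₀ = b ∧ s ≫ p₁ = c ∧ s ▷ _ ≫ H = h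
  hom_ext {S : SSet.{u}} {s t : S ⟶ P} (h₀ : s ≫ p₀ = t ≫ p₀) (h₁ : s ≫ p₁ = t ≫ p₁)
    (h : s ▷ _ ≫ H = t ▷ _ ≫ H) : s = t

/-- The edge of `A` which a map `H : P × Δ¹ ⟶ A` associates with a vertex of `P`. -/
def arrowOf (H : P ⊗ Δ[1] ⟶ A) (x : P _⦋0⦌) : A _⦋1⦌ :=
  H.app (op ⦋1⦌) (prodSimplex (P.σ 0 x) edge01)

lemma whiskerRight_comp_eq_arrowOf (H : P ⊗ Δ[1] ⟶ A) (x : P _⦋0⦌) :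
    SSet.yonedaEquiv.symm x ▷ _ ≫ H = snd _ _ ≫ SSet.yonedaEquiv.symm (arrowOf H x) := by
  ext ⟨⟨k⟩⟩ ⟨y, z⟩
  refine Eq.trans ?_ (H.naturality_apply (SSet.stdSimplex.objEquiv z).op
    (prodSimplex (X := P) (Y := Δ[1]) (P.σ 0 x) edge01))
  refine congrArg (H.app _) (Prod.ext ?_ ?_)
  · change P.map _ _ = P.map _ (P.map _ _)
    rw [← Functor.map_comp_apply, ← op_comp]
    congr 3
    exact Subsingleton.elim _ _
  · ext i
    rfl

lemma eq_arrowOf {H : P ⊗ Δ[1] ⟶ A} {x : P _⦋0⦌} {t : A _⦋1⦌}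
    (h : SSet.yonedaEquiv.symm x ▷ _ ≫ H = snd _ _ ≫ SSet.yonedaEquiv.symm t) :
    t = arrowOf H x := by
  rw [whiskerRight_comp_eq_arrowOf] at h
  have : lift (SSet.const (SSet.stdSimplex.obj₀Equiv.{u}.symm 0)) (𝟙 _) ≫
      snd (Δ[0] : SSet.{u}) Δ[1] = 𝟙 _ := by simp
  have h' := lift (SSet.const (SSet.stdSimplex.obj₀Equiv.{u}.symm 0)) (𝟙 (Δ[1] : SSet.{u})) ≫= h
  simp only [← Category.assoc, this, Category.id_comp] at h'
  exact (SSet.yonedaEquiv.symm.injective h').symm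

lemma const_stdSimplex_injective {X : SSet.{u}} (n : ℕ) :
    Function.Injective (SSet.const : X _⦋0⦌ → ((Δ[n] : SSet.{u}) ⟶ X)) := fun x y h ↦ by
  have := (SSet.const (SSet.stdSimplex.obj₀Equiv.{u}.symm 0) : (Δ[0] : SSet.{u}) ⟶ Δ[n]) ≫= h
  rw [SSet.comp_const, SSet.comp_const] at this
  simpa only [SSet.yonedaEquiv_const] using congrArg SSet.yonedaEquiv this

/-- The initial vertex of a simplex. -/
def initialVertex {X : SSet.{u}} {n : ℕ} (x : X _⦋n⦌) : X _⦋0⦌ :=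
  X.map (SimplexCategory.const ⦋0⦌ ⦋n⦌ 0).op x

/-- The final vertex of a simplex. -/
def finalVertex {X : SSet.{u}} {n : ℕ} (x : X _⦋n⦌) : X _⦋0⦌ :=
  X.map (SimplexCategory.const ⦋0⦌ ⦋n⦌ (Fin.last n)).op x

lemma initialVertex_δ_succ {X : SSet.{u}} {n : ℕ} (x : X _⦋n + 1⦌) (i : Fin (n + 1)) :
    initialVertex (X.δ i.succ x) = initialVertex x := by
  change X.map _ (X.map _ x) = _
  rw [← Functor.map_comp_apply, ← op_comp]
  rfl

lemma finalVertex_δ_castSucc {X : SSet.{u}} {n : ℕ} (x : X _⦋n + 1⦌) (i : Fin (n + 1)) :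
    finalVertex (X.δ i.castSucc x) = finalVertex x := by
  change X.map _ (X.map _ x) = _
  have h : SimplexCategory.const ⦋0⦌ ⦋n⦌ (Fin.last n) ≫ SimplexCategory.δ i.castSucc =
      SimplexCategory.const ⦋0⦌ ⦋n + 1⦌ (Fin.last (n + 1)) := by
    rw [SimplexCategory.const_comp]
    congr 1
    exact Fin.succAbove_ne_last_last i.castSucc_ne_last
  rw [← Functor.map_comp_apply, ← op_comp, h]
  rfl

lemma initialVertex_one {X : SSet.{u}} (x : X _⦋1⦌) : initialVertex x = X.δ 1 x := by
  have h : SimplexCategory.const ⦋0⦌ ⦋1⦌ 0 = SimplexCategory.δ 1 := by decide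
  exact congrArg (fun φ : ⦋0⦌ ⟶ ⦋1⦌ ↦ X.map φ.op x) h

lemma finalVertex_one {X : SSet.{u}} (x : X _⦋1⦌) : finalVertex x = X.δ 0 x := by
  have h : SimplexCategory.const ⦋0⦌ ⦋1⦌ (Fin.last 1) = SimplexCategory.δ 0 := by decide
  exact congrArg (fun φ : ⦋0⦌ ⟶ ⦋1⦌ ↦ X.map φ.op x) h

lemma const_initialVertex {X Y : SSet.{u}} {n : ℕ} (x : X _⦋n⦌) :
    (SSet.const (SSet.stdSimplex.obj₀Equiv.{u}.symm 0) : Y ⟶ Δ[n]) ≫ SSet.yonedaEquiv.symm x =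
      SSet.const (initialVertex x) := by
  ext ⟨⟨k⟩⟩ y
  change X.map _ x = X.map _ (X.map _ x)
  rw [← Functor.map_comp_apply, ← op_comp]
  rfl

lemma const_finalVertex {X Y : SSet.{u}} {n : ℕ} (x : X _⦋n⦌) :
    (SSet.const (SSet.stdSimplex.obj₀Equiv.{u}.symm (Fin.last n)) : Y ⟶ Δ[n]) ≫
      SSet.yonedaEquiv.symm x = SSet.const (finalVertex x) := by
  ext ⟨⟨k⟩⟩ y
  change X.map _ x = X.map _ (X.map _ x)
  rw [← Functor.map_comp_apply, ← op_comp]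
  rfl

/-- An `n`-simplex of `P` is a bottom cone on `b`, `c`, `t` if its image in `B` is degenerate on
the vertex `b`, its image in `C` is `c`, and the prism in `A` is obtained from the
`(n+1)`-simplex `t` by collapsing the bottom of the prism. -/
structure IsBottomCone (p₀ : P ⟶ B) (p₁ : P ⟶ C) (H : P ⊗ Δ[1] ⟶ A) {n : ℕ} (x : P _⦋n⦌)
    (b : B _⦋0⦌) (c : C _⦋n⦌) (t : A _⦋n + 1⦌) : Prop where
  fst : SSet.yonedaEquiv.symm x ≫ p₀ = SSet.const b
  snd : p₁.app _ x = c
  prism : SSet.yonedaEquiv.symm x ▷ _ ≫ H = collapseBottom n ≫ SSet.yonedaEquiv.symm t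

/-- An `n`-simplex of `P` is a top cone on `b`, `c`, `t` if its image in `B` is `b`, its image in
`C` is degenerate on the vertex `c`, and the prism in `A` is obtained from the
`(n+1)`-simplex `t` by collapsing the top of the prism. -/
structure IsTopCone (p₀ : P ⟶ B) (p₁ : P ⟶ C) (H : P ⊗ Δ[1] ⟶ A) {n : ℕ} (x : P _⦋n⦌)
    (b : B _⦋n⦌) (c : C _⦋0⦌) (t : A _⦋n + 1⦌) : Prop where
  fst : p₀.app _ x = b
  snd : SSet.yonedaEquiv.symm x ≫ p₁ = SSet.const c
  prism : SSet.yonedaEquiv.symm x ▷ _ ≫ H = collapseTop n ≫ SSet.yonedaEquiv.symm t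

variable {f : B ⟶ A} {g : C ⟶ A} {p₀ : P ⟶ B} {p₁ : P ⟶ C} {H : P ⊗ Δ[1] ⟶ A}

namespace IsBottomCone

variable {n : ℕ} {b : B _⦋0⦌}

lemma δ {x : P _⦋n + 1⦌} {c : C _⦋n + 1⦌} {t : A _⦋n + 2⦌} (h : IsBottomCone p₀ p₁ H x b c t)
    (i : Fin (n + 2)) : IsBottomCone p₀ p₁ H (P.δ i x) b (C.δ i c) (A.δ i.succ t) where
  fst := by
    rw [← SSet.stdSimplex.δ_comp_yonedaEquiv_symm, Category.assoc, h.fst]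
    rfl
  snd := by rw [SSet.δ_naturality_apply, h.snd]
  prism := by
    rw [← SSet.stdSimplex.δ_comp_yonedaEquiv_symm, ← SSet.stdSimplex.δ_comp_yonedaEquiv_symm,
      MonoidalCategory.comp_whiskerRight, Category.assoc, h.prism, ← Category.assoc,
      δ_whiskerRight_collapseBottom, Category.assoc]

lemma σ {x : P _⦋n⦌} {c : C _⦋n⦌} {t : A _⦋n + 1⦌} (h : IsBottomCone p₀ p₁ H x b c t)
    (i : Fin (n + 1)) : IsBottomCone p₀ p₁ H (P.σ i x) b (C.σ i c) (A.σ i.succ t) where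
  fst := by
    rw [← SSet.stdSimplex.σ_comp_yonedaEquiv_symm, Category.assoc, h.fst]
    rfl
  snd := by rw [SSet.σ_naturality_apply, h.snd]
  prism := by
    rw [← SSet.stdSimplex.σ_comp_yonedaEquiv_symm, ← SSet.stdSimplex.σ_comp_yonedaEquiv_symm,
      MonoidalCategory.comp_whiskerRight, Category.assoc, h.prism, ← Category.assoc,
      σ_whiskerRight_collapseBottom, Category.assoc]

end IsBottomCone

namespace IsTopCone

variable {n : ℕ} {c : C _⦋0⦌}

lemma δ {x : P _⦋n + 1⦌} {b : B _⦋n + 1⦌} {t : A _⦋n + 2⦌} (h : IsTopCone p₀ p₁ H x b c t)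
    (i : Fin (n + 2)) : IsTopCone p₀ p₁ H (P.δ i x) (B.δ i b) c (A.δ i.castSucc t) where
  fst := by rw [SSet.δ_naturality_apply, h.fst]
  snd := by
    rw [← SSet.stdSimplex.δ_comp_yonedaEquiv_symm, Category.assoc, h.snd]
    rfl
  prism := by
    rw [← SSet.stdSimplex.δ_comp_yonedaEquiv_symm, ← SSet.stdSimplex.δ_comp_yonedaEquiv_symm,
      MonoidalCategory.comp_whiskerRight, Category.assoc, h.prism, ← Category.assoc,
      δ_whiskerRight_collapseTop, Category.assoc]

lemma σ {x : P _⦋n⦌} {b : B _⦋n⦌} {t : A _⦋n + 1⦌} (h : IsTopCone p₀ p₁ H x b c t)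
    (i : Fin (n + 1)) : IsTopCone p₀ p₁ H (P.σ i x) (B.σ i b) c (A.σ i.castSucc t) where
  fst := by rw [SSet.σ_naturality_apply, h.fst]
  snd := by
    rw [← SSet.stdSimplex.σ_comp_yonedaEquiv_symm, Category.assoc, h.snd]
    rfl
  prism := by
    rw [← SSet.stdSimplex.σ_comp_yonedaEquiv_symm, ← SSet.stdSimplex.σ_comp_yonedaEquiv_symm,
      MonoidalCategory.comp_whiskerRight, Category.assoc, h.prism, ← Category.assoc,
      σ_whiskerRight_collapseTop, Category.assoc]

end IsTopCone

lemma isBottomCone_zero_iff {x : P _⦋0⦌} {b : B _⦋0⦌} {c : C _⦋0⦌} {t : A _⦋1⦌} :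
    IsBottomCone p₀ p₁ H x b c t ↔ p₀.app _ x = b ∧ p₁.app _ x = c ∧ arrowOf H x = t := by
  constructor
  · intro h
    refine ⟨?_, h.snd, (eq_arrowOf ?_).symm⟩
    · have := congrArg SSet.yonedaEquiv h.fst
      rwa [SSet.yonedaEquiv_comp, Equiv.apply_symm_apply, SSet.yonedaEquiv_const] at this
    · rw [h.prism, collapseBottom_zero]
  · rintro ⟨rfl, rfl, rfl⟩
    refine ⟨?_, rfl, ?_⟩
    · rw [SSet.yonedaEquiv_symm_comp, SSet.yonedaEquiv_symm_zero]
    · rw [whiskerRight_comp_eq_arrowOf, collapseBottom_zero]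

lemma isTopCone_zero_iff {x : P _⦋0⦌} {b : B _⦋0⦌} {c : C _⦋0⦌} {t : A _⦋1⦌} :
    IsTopCone p₀ p₁ H x b c t ↔ p₀.app _ x = b ∧ p₁.app _ x = c ∧ arrowOf H x = t := by
  constructor
  · intro h
    refine ⟨h.fst, ?_, (eq_arrowOf ?_).symm⟩
    · have := congrArg SSet.yonedaEquiv h.snd
      rwa [SSet.yonedaEquiv_comp, Equiv.apply_symm_apply, SSet.yonedaEquiv_const] at this
    · rw [h.prism, collapseTop_zero]
  · rintro ⟨rfl, rfl, rfl⟩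
    refine ⟨rfl, ?_, ?_⟩
    · rw [SSet.yonedaEquiv_symm_comp, SSet.yonedaEquiv_symm_zero]
    · rw [whiskerRight_comp_eq_arrowOf, collapseTop_zero]

namespace IsComma

variable (hP : IsComma f g p₀ p₁ H)
include hP

/-- The cone data fix all three components of the classifying map Δⁿ → P. Faces of fillers in P are
identified this way. -/
lemma bottomCone_unique {n : ℕ} {x y : P _⦋n⦌} {b : B _⦋0⦌} {c : C _⦋n⦌} {t : A _⦋n + 1⦌}
    (hx : IsBottomCone p₀ p₁ H x b c t) (hy : IsBottomCone p₀ p₁ H y b c t) : x = y := by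
  apply SSet.yonedaEquiv.symm.injective
  refine hP.hom_ext (hx.fst.trans hy.fst.symm) ?_ (hx.prism.trans hy.prism.symm)
  rw [SSet.yonedaEquiv_symm_comp, SSet.yonedaEquiv_symm_comp, hx.snd, hy.snd]

lemma topCone_unique {n : ℕ} {x y : P _⦋n⦌} {b : B _⦋n⦌} {c : C _⦋0⦌} {t : A _⦋n + 1⦌}
    (hx : IsTopCone p₀ p₁ H x b c t) (hy : IsTopCone p₀ p₁ H y b c t) : x = y := by
  apply SSet.yonedaEquiv.symm.injective
  refine hP.hom_ext ?_ (hx.snd.trans hy.snd.symm) (hx.prism.trans hy.prism.symm)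
  rw [SSet.yonedaEquiv_symm_comp, SSet.yonedaEquiv_symm_comp, hx.fst, hy.fst]

lemma vertex_ext {x y : P _⦋0⦌} (h₀ : p₀.app _ x = p₀.app _ y) (h₁ : p₁.app _ x = p₁.app _ y)
    (h : arrowOf H x = arrowOf H y) : x = y :=
  hP.bottomCone_unique (isBottomCone_zero_iff.2 ⟨h₀, h₁, h⟩)
    (isBottomCone_zero_iff.2 ⟨rfl, rfl, rfl⟩)

/-- The collapsed prism is constant at the initial vertex of `t` on its bottom and is the face `δ 0`
of `t` on its top, so the two hypotheses are exactly the boundary conditions of a homotopy. -/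
lemma exists_bottomCone {n : ℕ} (b : B _⦋0⦌) (c : C _⦋n⦌) (t : A _⦋n + 1⦌)
    (h₀ : initialVertex t = f.app _ b) (h₁ : A.δ 0 t = g.app _ c) :
    ∃ x : P _⦋n⦌, IsBottomCone p₀ p₁ H x b c t := by
  obtain ⟨s, hs₀, hs₁, hs⟩ := hP.exists_lift (SSet.const b) (SSet.yonedaEquiv.symm c)
    (collapseBottom n ≫ SSet.yonedaEquiv.symm t)
    (by rw [← Category.assoc, ι₀_collapseBottom, const_initialVertex, h₀,
      SSet.const_comp])
    (by rw [← Category.assoc, ι₁_collapseBottom, SSet.stdSimplex.δ_comp_yonedaEquiv_symm, h₁,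
      SSet.yonedaEquiv_symm_comp])
  refine ⟨SSet.yonedaEquiv s, ?_, ?_, ?_⟩
  · rw [Equiv.symm_apply_apply, hs₀]
  · rw [← SSet.yonedaEquiv_comp, hs₁, Equiv.apply_symm_apply]
  · rw [Equiv.symm_apply_apply, hs]

lemma exists_topCone {n : ℕ} (b : B _⦋n⦌) (c : C _⦋0⦌) (t : A _⦋n + 1⦌)
    (h₀ : A.δ (Fin.last _) t = f.app _ b) (h₁ : finalVertex t = g.app _ c) :
    ∃ x : P _⦋n⦌, IsTopCone p₀ p₁ H x b c t := by
  obtain ⟨s, hs₀, hs₁, hs⟩ := hP.exists_lift (SSet.yonedaEquiv.symm b) (SSet.const c)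
    (collapseTop n ≫ SSet.yonedaEquiv.symm t)
    (by rw [← Category.assoc, ι₀_collapseTop, SSet.stdSimplex.δ_comp_yonedaEquiv_symm, h₀,
      SSet.yonedaEquiv_symm_comp])
    (by rw [← Category.assoc, ι₁_collapseTop, const_finalVertex, h₁, SSet.const_comp])
  refine ⟨SSet.yonedaEquiv s, ?_, ?_, ?_⟩
  · rw [← SSet.yonedaEquiv_comp, hs₀, Equiv.apply_symm_apply]
  · rw [Equiv.symm_apply_apply, hs₁]
  · rw [Equiv.symm_apply_apply, hs]

lemma initialVertex_of_bottomCone {n : ℕ} {x : P _⦋n⦌} {b : B _⦋0⦌} {c : C _⦋n⦌} {t : A _⦋n + 1⦌}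
    (hx : IsBottomCone p₀ p₁ H x b c t) : initialVertex t = f.app _ b := by
  have h := SSet.ι₀ ≫= hx.prism
  rw [SSet.ι₀_comp_assoc, hP.ι₀_comp, ← Category.assoc, ← Category.assoc, hx.fst,
    ι₀_collapseBottom, const_initialVertex, SSet.const_comp] at h
  exact (const_stdSimplex_injective _ h).symm

lemma δ_zero_of_bottomCone {n : ℕ} {x : P _⦋n⦌} {b : B _⦋0⦌} {c : C _⦋n⦌} {t : A _⦋n + 1⦌}
    (hx : IsBottomCone p₀ p₁ H x b c t) : A.δ 0 t = g.app _ c := by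
  have h := SSet.ι₁ ≫= hx.prism
  rw [SSet.ι₁_comp_assoc, hP.ι₁_comp, ← Category.assoc, ← Category.assoc,
    ι₁_collapseBottom, SSet.stdSimplex.δ_comp_yonedaEquiv_symm, SSet.yonedaEquiv_symm_comp,
    SSet.yonedaEquiv_symm_comp, hx.snd] at h
  exact (SSet.yonedaEquiv.symm.injective h).symm

lemma finalVertex_of_topCone {n : ℕ} {x : P _⦋n⦌} {b : B _⦋n⦌} {c : C _⦋0⦌} {t : A _⦋n + 1⦌}
    (hx : IsTopCone p₀ p₁ H x b c t) : finalVertex t = g.app _ c := by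
  have h := SSet.ι₁ ≫= hx.prism
  rw [SSet.ι₁_comp_assoc, hP.ι₁_comp, ← Category.assoc, ← Category.assoc, hx.snd,
    ι₁_collapseTop, const_finalVertex, SSet.const_comp] at h
  exact (const_stdSimplex_injective _ h).symm

lemma δ_last_of_topCone {n : ℕ} {x : P _⦋n⦌} {b : B _⦋n⦌} {c : C _⦋0⦌} {t : A _⦋n + 1⦌}
    (hx : IsTopCone p₀ p₁ H x b c t) : A.δ (Fin.last _) t = f.app _ b := by
  have h := SSet.ι₀ ≫= hx.prism
  rw [SSet.ι₀_comp_assoc, hP.ι₀_comp, ← Category.assoc, ← Category.assoc,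
    ι₀_collapseTop, SSet.stdSimplex.δ_comp_yonedaEquiv_symm, SSet.yonedaEquiv_symm_comp,
    SSet.yonedaEquiv_symm_comp, hx.fst] at h
  exact (SSet.yonedaEquiv.symm.injective h).symm

end IsComma

end Cones

/-! ### Invertible edges -/

section Invertible

open SSet.Truncated.HomotopyCategory

variable {X : SSet.{u}}

lemma δ_σ_eq_self {n : ℕ} {i : Fin (n + 2)} {j : Fin (n + 1)} (s : X _⦋n⦌)
    (h : SimplexCategory.δ i ≫ SimplexCategory.σ j = 𝟙 _ := by decide) :
    X.δ i (X.σ j s) = s := by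
  have : X.δ i (X.σ j s) = X.map (SimplexCategory.δ i ≫ SimplexCategory.σ j).op s := by
    rw [op_comp, X.map_comp]; rfl
  rw [this, h, op_id, X.map_id]
  rfl

lemma δ_σ_eq {n : ℕ} {i : Fin (n + 3)} {j : Fin (n + 2)} {k : Fin (n + 1)} {l : Fin (n + 2)}
    (s : X _⦋n + 1⦌)
    (h : SimplexCategory.δ i ≫ SimplexCategory.σ j =
      SimplexCategory.σ k ≫ SimplexCategory.δ l := by decide) :
    X.δ i (X.σ j s) = X.σ k (X.δ l s) := by
  have h₁ : X.δ i (X.σ j s) = X.map (SimplexCategory.δ i ≫ SimplexCategory.σ j).op s := by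
    rw [op_comp, X.map_comp]; rfl
  have h₂ : X.σ k (X.δ l s) = X.map (SimplexCategory.σ k ≫ SimplexCategory.δ l).op s := by
    rw [op_comp, X.map_comp]; rfl
  rw [h₁, h₂, h]

/-- A 1-simplex is invertible if its class in the homotopy category is an isomorphism. -/
def IsInvertible (e : X _⦋1⦌) : Prop := IsIso (homMk (SSet.Edge.mk' e).toTruncated)

lemma yonedaEquiv_symm_σ_zero (x : X _⦋0⦌) :
    SSet.yonedaEquiv.symm (X.σ 0 x) = SSet.const x := by
  rw [← SSet.stdSimplex.σ_comp_yonedaEquiv_symm, SSet.yonedaEquiv_symm_zero, SSet.comp_const]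

lemma isInvertible_edge_iff {x y : X _⦋0⦌} (e : SSet.Edge x y) :
    IsInvertible e.edge ↔ IsIso (homMk e.toTruncated) := by
  obtain ⟨e, rfl, rfl⟩ := e
  rfl

lemma exists_homMk_comp (s : X _⦋2⦌) :
    ∃ (x y z : X _⦋0⦌) (e₀₁ : SSet.Edge x y) (e₁₂ : SSet.Edge y z) (e₀₂ : SSet.Edge x z),
      X.δ 2 s = e₀₁.edge ∧ X.δ 0 s = e₁₂.edge ∧ X.δ 1 s = e₀₂.edge ∧
      homMk e₀₁.toTruncated ≫ homMk e₁₂.toTruncated = homMk e₀₂.toTruncated := by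
  obtain ⟨x, y, z, e₀₁, e₁₂, e₀₂, h, rfl⟩ := SSet.Edge.CompStruct.exists_of_simplex s
  exact ⟨x, y, z, e₀₁, e₁₂, e₀₂, h.d₂, h.d₀, h.d₁, homMk_comp_homMk h.toTruncated⟩

lemma IsInvertible.comp {s : X _⦋2⦌} (h₂ : IsInvertible (X.δ 2 s)) (h₀ : IsInvertible (X.δ 0 s)) :
    IsInvertible (X.δ 1 s) := by
  obtain ⟨x, y, z, e₀₁, e₁₂, e₀₂, hs₂, hs₀, hs₁, h⟩ := exists_homMk_comp s
  rw [hs₂, isInvertible_edge_iff] at h₂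
  rw [hs₀, isInvertible_edge_iff] at h₀
  rw [hs₁, isInvertible_edge_iff, ← h]
  infer_instance

/-- The endpoints of a degenerate edge agree only propositionally, hence the `eqToHom`. -/
lemma homMk_eq_eqToHom_of_edge_eq_σ {x y : X _⦋0⦌} (e : SSet.Edge x y) {z : X _⦋0⦌}
    (h : e.edge = X.σ 0 z) :
    ∃ h : x = y, homMk e.toTruncated = eqToHom (congrArg mk h) := by
  have hx : x = z := by
    rw [← e.src_eq, h]
    exact δ_σ_eq_self z
  have hy : y = z := by
    rw [← e.tgt_eq, h]
    exact δ_σ_eq_self z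
  subst hx hy
  obtain rfl : e = SSet.Edge.id y := SSet.Edge.ext h
  exact ⟨rfl, homMk_id _⟩

/-- If `e` has a right inverse `δ₀ s` that itself has a right inverse, then `e` is invertible. -/
lemma isInvertible_of_right_inverses {s s' : X _⦋2⦌} {x x' : X _⦋0⦌} (hs : X.δ 1 s = X.σ 0 x)
    (hs' : X.δ 1 s' = X.σ 0 x') (h : X.δ 2 s' = X.δ 0 s) : IsInvertible (X.δ 2 s) := by
  obtain ⟨_, _, _, e, r, i, h₂, h₀, h₁, hc⟩ := exists_homMk_comp s
  obtain ⟨_, _, _, r', q, j, h₂', h₀', h₁', hc'⟩ := exists_homMk_comp s'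
  rw [h₂, isInvertible_edge_iff]
  obtain ⟨rfl, hi⟩ := homMk_eq_eqToHom_of_edge_eq_σ i (h₁.symm.trans hs)
  obtain ⟨rfl, hj⟩ := homMk_eq_eqToHom_of_edge_eq_σ j (h₁'.symm.trans hs')
  have hr : r'.edge = r.edge := by rw [← h₂', h, h₀]
  obtain rfl : _ = _ := r'.src_eq.symm.trans ((congrArg _ hr).trans r.src_eq)
  obtain rfl : _ = _ := r'.tgt_eq.symm.trans ((congrArg _ hr).trans r.tgt_eq)
  obtain rfl : r' = r := SSet.Edge.ext hr
  rw [hi, eqToHom_refl] at hc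
  rw [hj, eqToHom_refl] at hc'
  have : homMk q.toTruncated = homMk e.toTruncated := by
    rw [← Category.id_comp (homMk q.toTruncated), ← hc, Category.assoc, hc', Category.comp_id]
  exact ⟨_, hc, this ▸ hc'⟩

/-- If `e` has a left inverse `δ₂ s` that itself has a left inverse, then `e` is invertible. -/
lemma isInvertible_of_left_inverses {s s' : X _⦋2⦌} {x x' : X _⦋0⦌} (hs : X.δ 1 s = X.σ 0 x)
    (hs' : X.δ 1 s' = X.σ 0 x') (h : X.δ 0 s' = X.δ 2 s) : IsInvertible (X.δ 0 s) := by
  obtain ⟨_, _, _, r, e, i, h₂, h₀, h₁, hc⟩ := exists_homMk_comp s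
  obtain ⟨_, _, _, q, r', j, h₂', h₀', h₁', hc'⟩ := exists_homMk_comp s'
  rw [h₀, isInvertible_edge_iff]
  obtain ⟨rfl, hi⟩ := homMk_eq_eqToHom_of_edge_eq_σ i (h₁.symm.trans hs)
  obtain ⟨rfl, hj⟩ := homMk_eq_eqToHom_of_edge_eq_σ j (h₁'.symm.trans hs')
  have hr : r'.edge = r.edge := by rw [← h₀', h, h₂]
  obtain rfl : _ = _ := r'.src_eq.symm.trans ((congrArg _ hr).trans r.src_eq)
  obtain rfl : _ = _ := r'.tgt_eq.symm.trans ((congrArg _ hr).trans r.tgt_eq)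
  obtain rfl : r' = r := SSet.Edge.ext hr
  rw [hi, eqToHom_refl] at hc
  rw [hj, eqToHom_refl] at hc'
  have : homMk q.toTruncated = homMk e.toTruncated := by
    rw [← Category.comp_id (homMk q.toTruncated), ← hc, ← Category.assoc, hc', Category.id_comp]
  exact ⟨_, this ▸ hc', hc⟩

variable [SSet.Quasicategory X]

lemma IsInvertible.exists_right_inverse {e : X _⦋1⦌} (he : IsInvertible e) :
    ∃ s : X _⦋2⦌, X.δ 2 s = e ∧ X.δ 1 s = X.σ 0 (X.δ 1 e) ∧ IsInvertible (X.δ 0 s) := by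
  have : IsIso (homMk (SSet.Edge.mk' e).toTruncated) := he
  obtain ⟨r, hr⟩ := homMk_surjective (inv (homMk (SSet.Edge.mk' e).toTruncated))
  obtain ⟨c⟩ := nonempty_compStruct (e₀₁ := (SSet.Edge.mk' e).toTruncated) (e₁₂ := r)
    (e₀₂ := .id _) (by
      rw [hr, IsIso.hom_inv_id]
      exact (homMk_id _).symm)
  refine ⟨c.simplex, c.d₂, c.d₁, ?_⟩
  have h : X.δ 0 c.simplex = (SSet.Edge.ofTruncated r).edge := c.d₀
  rw [h, isInvertible_edge_iff]
  change IsIso (homMk r)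
  rw [hr]
  infer_instance

lemma IsInvertible.exists_left_inverse {e : X _⦋1⦌} (he : IsInvertible e) :
    ∃ s : X _⦋2⦌, X.δ 0 s = e ∧ X.δ 1 s = X.σ 0 (X.δ 0 e) ∧ IsInvertible (X.δ 2 s) := by
  have : IsIso (homMk (SSet.Edge.mk' e).toTruncated) := he
  obtain ⟨r, hr⟩ := homMk_surjective (inv (homMk (SSet.Edge.mk' e).toTruncated))
  obtain ⟨c⟩ := nonempty_compStruct (e₁₂ := (SSet.Edge.mk' e).toTruncated) (e₀₁ := r)
    (e₀₂ := .id _) (by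
      rw [hr, IsIso.inv_hom_id]
      exact (homMk_id _).symm)
  refine ⟨c.simplex, c.d₀, c.d₁, ?_⟩
  have h : X.δ 2 c.simplex = (SSet.Edge.ofTruncated r).edge := c.d₂
  rw [h, isInvertible_edge_iff]
  change IsIso (homMk r)
  rw [hr]
  infer_instance

end Invertible

/-! ### Surjectivity, fullness and conservativity on vertices and edges -/

namespace IsComma

open SSet.Truncated.HomotopyCategory

variable {A B C P : SSet.{u}} {f : B ⟶ A} {g : C ⟶ A} {p₀ : P ⟶ B} {p₁ : P ⟶ C}
  {H : P ⊗ Δ[1] ⟶ A} (hP : IsComma f g p₀ p₁ H)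
include hP

lemma exists_vertex {b : B _⦋0⦌} {c : C _⦋0⦌} (t : SSet.Edge (f.app _ b) (g.app _ c)) :
    ∃ x : P _⦋0⦌, p₀.app _ x = b ∧ p₁.app _ x = c ∧ arrowOf H x = t.edge := by
  obtain ⟨x, hx⟩ := hP.exists_bottomCone b c t.edge
    ((initialVertex_one _).trans t.src_eq) t.tgt_eq
  exact ⟨x, isBottomCone_zero_iff.1 hx⟩

/-- Coning off a 2-simplex of C that exhibits a right inverse of `c` asks for a 3-simplex of A with
faces 0, 2, 3 prescribed: the inner horn Λ³₁. The new face 1 is the triangle of the inverse, again a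
bottom cone over an invertible edge, so the lemma can be iterated. -/
lemma exists_right_inverse_of_bottomCone [SSet.Quasicategory A] [SSet.Quasicategory C]
    {e : P _⦋1⦌} {b : B _⦋0⦌} {c : C _⦋1⦌} {t : A _⦋2⦌} (he : IsBottomCone p₀ p₁ H e b c t)
    (hc : IsInvertible c) :
    ∃ (s : P _⦋2⦌) (c' : C _⦋1⦌) (t' : A _⦋2⦌), P.δ 2 s = e ∧ P.δ 1 s = P.σ 0 (P.δ 1 e) ∧
      IsBottomCone p₀ p₁ H (P.δ 0 s) b c' t' ∧ IsInvertible c' := by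
  obtain ⟨c₂, h₂, h₁, h₀⟩ := hc.exists_right_inverse
  have ht := hP.δ_zero_of_bottomCone he
  -- By the index shift, face 3 of `r` gives back `e`, and the degenerate face 2 makes the composite
  -- in P an identity.
  obtain ⟨r, hr₀, hr₂, hr₃⟩ := exists_simplex_of_horn₃₁ (g.app _ c₂) (A.σ 1 (A.δ 2 t)) t
    (by rw [← SSet.δ_naturality_apply, h₂, ht])
    (by
      refine Eq.trans ?_ (δ_σ_eq (k := 0) (l := 0) _).symm
      rw [← SSet.δ_naturality_apply, h₁, SSet.σ_naturality_apply, SSet.δ_naturality_apply, ← ht]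
      exact congrArg _ (δ_δ_eq _))
    (δ_σ_eq_self _)
  obtain ⟨s, hs⟩ := hP.exists_bottomCone b c₂ r
    (by rw [← initialVertex_δ_succ r 2, ← hP.initialVertex_of_bottomCone he]
        exact congrArg initialVertex hr₃) hr₀
  refine ⟨s, _, _, hP.bottomCone_unique (hs.δ 2) ?_, hP.bottomCone_unique (hs.δ 1) ?_, hs.δ 0, h₀⟩
  · rw [h₂]
    exact hr₃ ▸ he
  · rw [h₁]
    exact hr₂ ▸ (he.δ 1).σ 0

lemma isInvertible_of_bottomCone [SSet.Quasicategory A] [SSet.Quasicategory C]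
    {e : P _⦋1⦌} {b : B _⦋0⦌} {c : C _⦋1⦌} {t : A _⦋2⦌} (he : IsBottomCone p₀ p₁ H e b c t)
    (hc : IsInvertible c) : IsInvertible e := by
  obtain ⟨s, _, _, rfl, h, hs, hc'⟩ := hP.exists_right_inverse_of_bottomCone he hc
  obtain ⟨s', _, _, h', h'', -, -⟩ := hP.exists_right_inverse_of_bottomCone hs hc'
  exact isInvertible_of_right_inverses h h'' h'

/-- Dual: the cone point is last, a left inverse of `b` is used, and the horn is Λ³₂. -/
lemma exists_left_inverse_of_topCone [SSet.Quasicategory A] [SSet.Quasicategory B]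
    {e : P _⦋1⦌} {b : B _⦋1⦌} {c : C _⦋0⦌} {t : A _⦋2⦌} (he : IsTopCone p₀ p₁ H e b c t)
    (hb : IsInvertible b) :
    ∃ (s : P _⦋2⦌) (b' : B _⦋1⦌) (t' : A _⦋2⦌), P.δ 0 s = e ∧ P.δ 1 s = P.σ 0 (P.δ 0 e) ∧
      IsTopCone p₀ p₁ H (P.δ 2 s) b' c t' ∧ IsInvertible b' := by
  obtain ⟨b₂, h₀, h₁, h₂⟩ := hb.exists_left_inverse
  have ht : A.δ 2 t = _ := hP.δ_last_of_topCone he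
  obtain ⟨r, hr₀, hr₁, hr₃⟩ := exists_simplex_of_horn₃₂ t (A.σ 0 (A.δ 0 t)) (f.app _ b₂)
    (by
      refine (δ_σ_eq (k := 0) (l := 1) _).trans ?_
      rw [← SSet.δ_naturality_apply, h₁, SSet.σ_naturality_apply, SSet.δ_naturality_apply, ← ht]
      exact congrArg _ (δ_δ_eq _))
    (by rw [← SSet.δ_naturality_apply, h₀, ht])
    (δ_σ_eq_self _).symm
  obtain ⟨s, hs⟩ := hP.exists_topCone b₂ c r hr₃
    (by rw [← finalVertex_δ_castSucc r 0, ← hP.finalVertex_of_topCone he]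
        exact congrArg finalVertex hr₀)
  refine ⟨s, _, _, hP.topCone_unique (hs.δ 0) ?_, hP.topCone_unique (hs.δ 1) ?_, hs.δ 2, h₂⟩
  · rw [h₀]
    exact hr₀ ▸ he
  · rw [h₁]
    exact hr₁ ▸ (he.δ 0).σ 0

lemma isInvertible_of_topCone [SSet.Quasicategory A] [SSet.Quasicategory B]
    {e : P _⦋1⦌} {b : B _⦋1⦌} {c : C _⦋0⦌} {t : A _⦋2⦌} (he : IsTopCone p₀ p₁ H e b c t)
    (hb : IsInvertible b) : IsInvertible e := by
  obtain ⟨s, _, _, rfl, h, hs, hc'⟩ := hP.exists_left_inverse_of_topCone he hb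
  obtain ⟨s', _, _, h', h'', -, -⟩ := hP.exists_left_inverse_of_topCone hs hc'
  exact isInvertible_of_left_inverses h h'' h'

/-- Every edge of a comma simplicial set is a composite of a bottom cone and a top cone. -/
lemma exists_factorization (e : P _⦋1⦌) :
    ∃ (s : P _⦋2⦌) (t t' : A _⦋2⦌), P.δ 1 s = e ∧
      IsBottomCone p₀ p₁ H (P.δ 2 s) (B.δ 1 (p₀.app _ e)) (p₁.app _ e) t ∧
      IsTopCone p₀ p₁ H (P.δ 0 s) (p₀.app _ e) (C.δ 0 (p₁.app _ e)) t' := by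
  let φ : (Δ[1] ⊗ Δ[1] : SSet.{u}) ⟶ A := SSet.yonedaEquiv.symm e ▷ _ ≫ H
  -- The degeneracies match the two ends of `shear`: the first edge of the triangle is constant in
  -- B, the last constant in C, and the long edge is `e`.
  obtain ⟨s, hs₀, hs₁, hs⟩ := hP.exists_lift
    (SSet.yonedaEquiv.symm (B.σ 0 (p₀.app _ e))) (SSet.yonedaEquiv.symm (C.σ 1 (p₁.app _ e)))
    (shear ≫ φ)
    (by
      rw [← SSet.stdSimplex.σ_comp_yonedaEquiv_symm, ← Category.assoc, ι₀_shear, Category.assoc,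
        SSet.ι₀_comp_assoc, hP.ι₀_comp, ← SSet.yonedaEquiv_symm_comp]
      simp only [Category.assoc])
    (by
      rw [← SSet.stdSimplex.σ_comp_yonedaEquiv_symm, ← Category.assoc, ι₁_shear, Category.assoc,
        SSet.ι₁_comp_assoc, hP.ι₁_comp, ← SSet.yonedaEquiv_symm_comp]
      simp only [Category.assoc])
  have hδ (i : Fin 3) :
      SSet.yonedaEquiv.symm (P.δ i (SSet.yonedaEquiv s)) = SSet.stdSimplex.δ i ≫ s := by
    rw [← SSet.stdSimplex.δ_comp_yonedaEquiv_symm, Equiv.symm_apply_apply]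
  refine ⟨SSet.yonedaEquiv s,
    SSet.yonedaEquiv (lift (SSet.stdSimplex.σ 0) (SSet.stdSimplex.σ 1) ≫ φ),
    SSet.yonedaEquiv (lift (SSet.stdSimplex.σ 1) (SSet.stdSimplex.σ 0) ≫ φ), ?_, ⟨?_, ?_, ?_⟩,
    ⟨?_, ?_, ?_⟩⟩
  · apply SSet.yonedaEquiv.symm.injective
    rw [hδ]
    refine hP.hom_ext ?_ ?_ ?_
    · rw [Category.assoc, hs₀, SSet.stdSimplex.δ_comp_yonedaEquiv_symm, δ_σ_eq_self,
        SSet.yonedaEquiv_symm_comp]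
    · rw [Category.assoc, hs₁, SSet.stdSimplex.δ_comp_yonedaEquiv_symm, δ_σ_eq_self,
        SSet.yonedaEquiv_symm_comp]
    · rw [MonoidalCategory.comp_whiskerRight, Category.assoc, hs, ← Category.assoc,
        δ_one_whiskerRight_shear, Category.id_comp]
  · rw [hδ, Category.assoc, hs₀, SSet.stdSimplex.δ_comp_yonedaEquiv_symm,
      δ_σ_eq (k := 0) (l := 1), yonedaEquiv_symm_σ_zero]
  · rw [SSet.δ_naturality_apply, ← SSet.yonedaEquiv_comp, hs₁, Equiv.apply_symm_apply,
      δ_σ_eq_self]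
  · rw [hδ, MonoidalCategory.comp_whiskerRight, Category.assoc, hs, ← Category.assoc,
      δ_two_whiskerRight_shear, Equiv.symm_apply_apply, Category.assoc]
  · rw [SSet.δ_naturality_apply, ← SSet.yonedaEquiv_comp, hs₀, Equiv.apply_symm_apply,
      δ_σ_eq_self]
  · rw [hδ, Category.assoc, hs₁, SSet.stdSimplex.δ_comp_yonedaEquiv_symm,
      δ_σ_eq (k := 0) (l := 0), yonedaEquiv_symm_σ_zero]
  · rw [hδ, MonoidalCategory.comp_whiskerRight, Category.assoc, hs, ← Category.assoc,
      δ_zero_whiskerRight_shear, Equiv.symm_apply_apply, Category.assoc]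

/-- An edge of a comma simplicial set is invertible if both of its projections are. -/
theorem isInvertible [SSet.Quasicategory A] [SSet.Quasicategory B] [SSet.Quasicategory C]
    {e : P _⦋1⦌} (h₀ : IsInvertible (p₀.app _ e)) (h₁ : IsInvertible (p₁.app _ e)) :
    IsInvertible e := by
  obtain ⟨s, _, _, rfl, hs₂, hs₀⟩ := hP.exists_factorization e
  exact (hP.isInvertible_of_bottomCone hs₂ h₁).comp (hP.isInvertible_of_topCone hs₀ h₀)

/-- Fullness: edges between the projections of `x` and `y` that are compatible up to homotopy with
the edges of `A` given by `x` and `y` lift to a morphism of the homotopy category of `P`. -/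
theorem exists_hom [SSet.Quasicategory A] {x y : P _⦋0⦌}
    (u : SSet.Edge (p₀.app _ x) (p₀.app _ y)) (v : SSet.Edge (p₁.app _ x) (p₁.app _ y))
    (h : homMk (u.map f).toTruncated ≫
        homMk (htpyEdge H hP.ι₀_comp hP.ι₁_comp y).toTruncated =
      homMk (htpyEdge H hP.ι₀_comp hP.ι₁_comp x).toTruncated ≫ homMk (v.map g).toTruncated) :
    ∃ m : SSet.Truncated.HomotopyCategory.mk (V := (SSet.truncation 2).obj P) x ⟶
        SSet.Truncated.HomotopyCategory.mk y,
      (SSet.Truncated.mapHomotopyCategory ((SSet.truncation 2).map p₀)).map m =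
        homMk u.toTruncated ∧
      (SSet.Truncated.mapHomotopyCategory ((SSet.truncation 2).map p₁)).map m =
        homMk v.toTruncated := by
  -- The same `d` must serve both triangles, since it becomes the arrow of the middle vertex.
  obtain ⟨d, hd⟩ := homMk_surjective (homMk (u.map f).toTruncated ≫
        homMk (htpyEdge H hP.ι₀_comp hP.ι₁_comp y).toTruncated)
  obtain ⟨T₁⟩ := nonempty_compStruct (h.symm.trans hd.symm)
  obtain ⟨T₂⟩ := nonempty_compStruct hd.symm
  obtain ⟨t₁, h₁₂, h₁₀, h₁₁⟩ : ∃ t : A _⦋2⦌, A.δ 2 t = arrowOf H x ∧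
      A.δ 0 t = g.app _ v.edge ∧ A.δ 1 t = d.edge := ⟨T₁.simplex, T₁.d₂, T₁.d₀, T₁.d₁⟩
  obtain ⟨t₂, h₂₂, h₂₀, h₂₁⟩ : ∃ t : A _⦋2⦌, A.δ 2 t = f.app _ u.edge ∧
      A.δ 0 t = arrowOf H y ∧ A.δ 1 t = d.edge := ⟨T₂.simplex, T₂.d₂, T₂.d₀, T₂.d₁⟩
  obtain ⟨e₁, he₁⟩ := hP.exists_bottomCone (p₀.app _ x) v.edge t₁
    (by
      rw [← initialVertex_δ_succ _ 1, initialVertex_one]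
      exact (congrArg (A.δ 1) h₁₂).trans (htpyEdge H hP.ι₀_comp hP.ι₁_comp x).src_eq) h₁₀
  obtain ⟨e₂, he₂⟩ := hP.exists_topCone u.edge (p₁.app _ y) t₂ h₂₂
    (by
      rw [← finalVertex_δ_castSucc _ 0, finalVertex_one]
      exact (congrArg (A.δ 0) h₂₀).trans (htpyEdge H hP.ι₀_comp hP.ι₁_comp y).tgt_eq)
  obtain ⟨hx₀, hx₁, hx⟩ := isBottomCone_zero_iff.1 (he₁.δ 1)
  obtain ⟨hz₀, hz₁, hz⟩ := isBottomCone_zero_iff.1 (he₁.δ 0)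
  obtain ⟨hz₀', hz₁', hz'⟩ := isTopCone_zero_iff.1 (he₂.δ 1)
  obtain ⟨hy₀, hy₁, hy⟩ := isTopCone_zero_iff.1 (he₂.δ 0)
  -- The middle vertex lies over the source of `u` and the target of `v`, with arrow `d`.
  let e₁' : SSet.Edge x (P.δ 0 e₁) := .mk e₁
    (hP.vertex_ext hx₀ (hx₁.trans v.src_eq) (hx.trans h₁₂)) rfl
  let e₂' : SSet.Edge (P.δ 0 e₁) y := .mk e₂
    (hP.vertex_ext (hz₀'.trans (u.src_eq.trans hz₀.symm))
      (hz₁'.trans (v.tgt_eq.symm.trans hz₁.symm))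
      (hz'.trans (h₂₁.trans (h₁₁.symm.trans hz.symm))))
    (hP.vertex_ext (hy₀.trans u.tgt_eq) hy₁ (hy.trans h₂₀))
  -- In B the two pieces are an identity and `u`, in C they are `v` and an identity; degenerate
  -- triangles compute both composites.
  refine ⟨homMk e₁'.toTruncated ≫ homMk e₂'.toTruncated, ?_, ?_⟩
  · rw [Functor.map_comp]
    refine homMk_comp_homMk (SSet.Edge.CompStruct.mk (e₀₁ := e₁'.map p₀) (e₁₂ := e₂'.map p₀)
      (e₀₂ := u) (B.σ 0 u.edge) ?_ ?_ ?_).toTruncated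
    · have := congrArg SSet.yonedaEquiv (he₁.fst.trans (yonedaEquiv_symm_σ_zero _).symm)
      rw [SSet.yonedaEquiv_comp, Equiv.apply_symm_apply, Equiv.apply_symm_apply] at this
      exact (δ_σ_eq (k := 0) (l := 1) _).trans ((congrArg _ u.src_eq).trans this.symm)
    · exact (δ_σ_eq_self _).trans he₂.fst.symm
    · exact δ_σ_eq_self _
  · rw [Functor.map_comp]
    refine homMk_comp_homMk (SSet.Edge.CompStruct.mk (e₀₁ := e₁'.map p₁) (e₁₂ := e₂'.map p₁)
      (e₀₂ := v) (C.σ 1 v.edge) ?_ ?_ ?_).toTruncated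
    · exact (δ_σ_eq_self _).trans he₁.snd.symm
    · have := congrArg SSet.yonedaEquiv (he₂.snd.trans (yonedaEquiv_symm_σ_zero _).symm)
      rw [SSet.yonedaEquiv_comp, Equiv.apply_symm_apply, Equiv.apply_symm_apply] at this
      exact (δ_σ_eq (k := 0) (l := 0) _).trans ((congrArg _ v.tgt_eq).trans this.symm)
    · exact δ_σ_eq_self _

end IsComma

/-! ### The comma simplicial set is a quasi-category -/

section Quasicategory

/-- The discrete simplicial set with two vertices. -/
def twoPoints : SSet.{u} := (SimplicialObject.const _).obj (ULift.{u} (Fin 2))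

/-- The inclusion of the two vertices of `Δ¹`. -/
def twoPointsι : twoPoints.{u} ⟶ Δ[1] where
  app n := ↾fun j ↦ (SSet.const (SSet.stdSimplex.obj₀Equiv.{u}.symm j.down) :
    (Δ[0] : SSet.{u}) ⟶ Δ[1]).app n (SSet.stdSimplex.objEquiv.symm (n.unop.const ⦋0⦌ 0))

instance : Mono twoPointsι.{u} := by
  have (n : SimplexCategoryᵒᵖ) : Mono (twoPointsι.{u}.app n) := by
    rw [mono_iff_injective]
    rintro ⟨i⟩ ⟨j⟩ h
    exact congrArg ULift.up
      (congrArg (fun x : (Δ[1] : SSet.{u}) _⦋n.unop.len⦌ ↦ x 0) h)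
  exact NatTrans.mono_of_mono_app _

/-- The inclusion of the copy of `S` in `twoPoints ⊗ S` over one of the points. -/
def twoPointsIncl (S : SSet.{u}) (i : Fin 2) : S ⟶ twoPoints ⊗ S :=
  lift { app _ := ↾fun _ ↦ ULift.up i } (𝟙 _)

lemma twoPointsIncl_ι (S : SSet.{u}) (i : Fin 2) :
    twoPointsIncl S i ≫ twoPointsι ▷ S =
      lift (SSet.const (SSet.stdSimplex.obj₀Equiv.{u}.symm i)) (𝟙 _) := rfl

lemma twoPointsIncl_naturality {S T : SSet.{u}} (φ : S ⟶ T) (i : Fin 2) :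
    twoPointsIncl S i ≫ _ ◁ φ = φ ≫ twoPointsIncl T i := rfl

variable {S A : SSet.{u}}

/-- The map `twoPoints ⊗ S ⟶ A` with given restrictions to the two copies of `S`. -/
def twoPointsDesc (a : Fin 2 → (S ⟶ A)) : twoPoints ⊗ S ⟶ A where
  app n := ↾fun x ↦ (a x.1.down).app n x.2
  naturality _ _ φ := by
    ext x
    exact (a x.1.down).naturality_apply φ x.2

lemma twoPointsIncl_desc (a : Fin 2 → (S ⟶ A)) (i : Fin 2) :
    twoPointsIncl S i ≫ twoPointsDesc a = a i := rfl

lemma twoPoints_hom_ext {a b : twoPoints ⊗ S ⟶ A}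
    (h : ∀ i, twoPointsIncl S i ≫ a = twoPointsIncl S i ≫ b) : a = b := by
  ext n ⟨⟨i⟩, x⟩
  exact ConcreteCategory.congr_hom (NatTrans.congr_app (h i) n) x

lemma comp_evVertex (φ : S ⟶ arrows A) (i : Fin 2) :
    φ ≫ evVertex A i =
      lift (SSet.const (SSet.stdSimplex.obj₀Equiv.{u}.symm i)) (𝟙 _) ≫
        MonoidalClosed.uncurry φ := by
  rw [MonoidalClosed.uncurry_eq]
  rfl

lemma comp_evVertex_eq_pre (φ : S ⟶ arrows A) (i : Fin 2) :
    φ ≫ evVertex A i = twoPointsIncl S i ≫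
      MonoidalClosed.uncurry (φ ≫ (MonoidalClosed.pre twoPointsι).app A) := by
  rw [comp_evVertex, MonoidalClosed.uncurry_pre_app, ← twoPointsIncl_ι, Category.assoc]

/-- Maps out of two copies of S are pairs of maps out of S, so a lifting problem against (target,
source) transposes to one against restriction along `twoPointsι`, an inner fibration because
`twoPointsι` is mono. -/
instance innerFibration_evVertex [SSet.Quasicategory A] :
    SSet.InnerFibration (lift (evVertex A 1) (evVertex A 0)) where
  mem {X Y} i hi := ⟨fun {s t} sq ↦ by
    have h₁ : s ≫ evVertex A 1 = i ≫ t ≫ fst _ _ := by simpa using sq.w =≫ fst _ _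
    have h₀ : s ≫ evVertex A 0 = i ≫ t ≫ snd _ _ := by simpa using sq.w =≫ snd _ _
    have := SSet.mem_innerFibrations ((MonoidalClosed.pre twoPointsι).app A) i hi
    -- Vertex 0 is the source, which is the second factor of A × A.
    have sq' : CommSq s i ((MonoidalClosed.pre twoPointsι).app A)
        (MonoidalClosed.curry (twoPointsDesc ![t ≫ snd _ _, t ≫ fst _ _])) := ⟨by
      apply MonoidalClosed.uncurry_injective
      refine twoPoints_hom_ext fun j ↦ ?_
      rw [← comp_evVertex_eq_pre, MonoidalClosed.uncurry_natural_left,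
        MonoidalClosed.uncurry_curry, ← Category.assoc, twoPointsIncl_naturality, Category.assoc,
        twoPointsIncl_desc]
      fin_cases j
      · exact h₀
      · exact h₁⟩
    have h (j : Fin 2) : sq'.lift ≫ evVertex A j = ![t ≫ snd _ _, t ≫ fst _ _] j := by
      rw [comp_evVertex_eq_pre, sq'.fac_right, MonoidalClosed.uncurry_curry, twoPointsIncl_desc]
    refine ⟨⟨⟨sq'.lift, sq'.fac_left, ?_⟩⟩⟩
    ext1
    · simpa using h 1
    · simpa using h 0⟩

instance quasicategory_tensor {B C : SSet.{u}} [SSet.Quasicategory B] [SSet.Quasicategory C] :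
    SSet.Quasicategory (C ⊗ B) where
  hornFilling' n i σ₀ h0 hn := by
    obtain ⟨σ, hσ⟩ := SSet.Quasicategory.hornFilling h0 hn (σ₀ ≫ fst _ _)
    obtain ⟨τ, hτ⟩ := SSet.Quasicategory.hornFilling h0 hn (σ₀ ≫ snd _ _)
    refine ⟨lift σ τ, ?_⟩
    ext1
    · simpa using hσ
    · simpa using hτ

variable {B C : SSet.{u}} (f : B ⟶ A) (g : C ⟶ A)

theorem quasicategory_commaObj [SSet.Quasicategory A] [SSet.Quasicategory B]
    [SSet.Quasicategory C] : SSet.Quasicategory (commaObj f g) := by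
  have : SSet.InnerFibration (commaProj f g) :=
    ⟨MorphismProperty.pullback_fst _ _ (SSet.mem_innerFibrations _)⟩
  exact SSet.quasicategory_of_innerFibration (commaProj f g)

end Quasicategory

/-! ### The universal property -/

section

variable {A B C : SSet.{u}} (f : B ⟶ A) (g : C ⟶ A)

/-- This combines the universal property of the pullback with the adjunction between Δ¹ × – and
exponentiation; the braiding puts Δ¹ on the other side. -/
theorem isComma_commaObj : IsComma f g (commaP₀ f g) (commaP₁ f g) (commaHtpy f g) where
  ι₀_comp := ι₀_commaHtpy f g
  ι₁_comp := ι₁_commaHtpy f g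
  exists_lift {S} b c h h₀ h₁ := by
    let k : S ⟶ arrows A := MonoidalClosed.curry ((β_ _ _).hom ≫ h)
    have hk : MonoidalClosed.uncurry k = (β_ _ _).hom ≫ h := MonoidalClosed.uncurry_curry _
    have hk₀ : k ≫ evVertex A 0 = b ≫ f := by
      rw [comp_evVertex, hk, ← h₀]
      rfl
    have hk₁ : k ≫ evVertex A 1 = c ≫ g := by
      rw [comp_evVertex, hk, ← h₁]
      rfl
    let s : S ⟶ commaObj f g := Limits.pullback.lift (lift c b) k (by
      ext1
      · simp [hk₁]
      · simp [hk₀])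
    have hs : s ≫ commaProj f g = lift c b := Limits.pullback.lift_fst _ _ _
    have hs' : s ≫ commaArrow f g = k := Limits.pullback.lift_snd _ _ _
    refine ⟨s, ?_, ?_, ?_⟩
    · rw [commaP₀, ← Category.assoc, hs, lift_snd]
    · rw [commaP₁, ← Category.assoc, hs, lift_fst]
    · rw [commaHtpy, BraidedCategory.braiding_naturality_left_assoc,
        ← MonoidalCategory.whiskerLeft_comp_assoc, hs', ← MonoidalClosed.uncurry_eq, hk,
        SymmetricCategory.symmetry_assoc]
  hom_ext {S s t} h₀ h₁ h := by
    refine Limits.pullback.hom_ext ?_ ?_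
    · change s ≫ commaProj f g = t ≫ commaProj f g
      ext1
      · simpa [commaP₁] using h₁
      · simpa [commaP₀] using h₀
    · change s ≫ commaArrow f g = t ≫ commaArrow f g
      apply MonoidalClosed.uncurry_injective
      rw [commaHtpy, BraidedCategory.braiding_naturality_left_assoc,
        BraidedCategory.braiding_naturality_left_assoc, cancel_epi,
        ← MonoidalCategory.whiskerLeft_comp_assoc, ← MonoidalCategory.whiskerLeft_comp_assoc,
        ← MonoidalClosed.uncurry_eq, ← MonoidalClosed.uncurry_eq] at h
      exact h

end

/-! ### Stability of the universal property under exponentiation -/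

section

variable {A B C P : SSet.{u}} {f : B ⟶ A} {g : C ⟶ A} {p₀ : P ⟶ B} {p₁ : P ⟶ C}

/-- The homotopy `Pᴷ × Δ¹ ⟶ Aᴷ` given by a homotopy `P × Δ¹ ⟶ A`. -/
def powHtpy (K : SSet.{u}) (H : P ⊗ Δ[1] ⟶ A) : (ihom K).obj P ⊗ Δ[1] ⟶ (ihom K).obj A :=
  MonoidalClosed.curry ((α_ _ _ _).inv ≫ (ihom.ev K).app P ▷ _ ≫ H)

lemma uncurry_whiskerRight_powHtpy {K S : SSet.{u}} (H : P ⊗ Δ[1] ⟶ A)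
    (s : S ⟶ (ihom K).obj P) :
    MonoidalClosed.uncurry (s ▷ _ ≫ powHtpy K H) =
      (α_ _ _ _).inv ≫ MonoidalClosed.uncurry s ▷ _ ≫ H := by
  rw [MonoidalClosed.uncurry_natural_left, powHtpy, MonoidalClosed.uncurry_curry,
    MonoidalClosed.uncurry_eq]
  simp

/-- Maps S → Pᴷ are maps K × S → P, so every clause is the original one for K × S. -/
lemma IsComma.pow {H : P ⊗ Δ[1] ⟶ A} (hP : IsComma f g p₀ p₁ H) (K : SSet.{u}) :
    IsComma ((ihom K).map f) ((ihom K).map g) ((ihom K).map p₀) ((ihom K).map p₁)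
      (powHtpy K H) where
  ι₀_comp := by
    apply MonoidalClosed.uncurry_injective
    rw [MonoidalClosed.uncurry_natural_left, powHtpy, MonoidalClosed.uncurry_curry,
      ← Functor.map_comp, MonoidalClosed.uncurry_ihom_map, ← hP.ι₀_comp]
    rfl
  ι₁_comp := by
    apply MonoidalClosed.uncurry_injective
    rw [MonoidalClosed.uncurry_natural_left, powHtpy, MonoidalClosed.uncurry_curry,
      ← Functor.map_comp, MonoidalClosed.uncurry_ihom_map, ← hP.ι₁_comp]
    rfl
  exists_lift {S} b c h h₀ h₁ := by
    obtain ⟨s, hs₀, hs₁, hs⟩ := hP.exists_lift (MonoidalClosed.uncurry b)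
      (MonoidalClosed.uncurry c) ((α_ _ _ _).hom ≫ MonoidalClosed.uncurry h)
      (by
        rw [← MonoidalClosed.uncurry_natural_right, ← h₀, MonoidalClosed.uncurry_natural_left]
        rfl)
      (by
        rw [← MonoidalClosed.uncurry_natural_right, ← h₁, MonoidalClosed.uncurry_natural_left]
        rfl)
    refine ⟨MonoidalClosed.curry s, ?_, ?_, ?_⟩
    · rw [← MonoidalClosed.curry_natural_right, hs₀, MonoidalClosed.curry_uncurry]
    · rw [← MonoidalClosed.curry_natural_right, hs₁, MonoidalClosed.curry_uncurry]
    · apply MonoidalClosed.uncurry_injective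
      rw [uncurry_whiskerRight_powHtpy, MonoidalClosed.uncurry_curry, hs, Iso.inv_hom_id_assoc]
  hom_ext {S s t} h₀ h₁ h := by
    apply MonoidalClosed.uncurry_injective
    refine hP.hom_ext ?_ ?_ ?_
    · simpa only [MonoidalClosed.uncurry_natural_right] using congrArg MonoidalClosed.uncurry h₀
    · simpa only [MonoidalClosed.uncurry_natural_right] using congrArg MonoidalClosed.uncurry h₁
    · have := congrArg MonoidalClosed.uncurry h
      rwa [uncurry_whiskerRight_powHtpy, uncurry_whiskerRight_powHtpy, cancel_epi] at this

/-- This links the arrow of a vertex of Pᴷ to the homotopy representing a whiskered 2-cell. -/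
lemma arrowOf_powHtpy {K : SSet.{u}} (H : P ⊗ Δ[1] ⟶ A) (a : K ⟶ P) :
    arrowOf (powHtpy K H) (homVertex a) = htpySimplex (a ▷ _ ≫ H) := by
  refine Functor.HomObj.ext ?_
  funext c φ
  ext x
  refine congrArg (H.app c) (Prod.ext rfl ?_)
  exact congrArg SSet.stdSimplex.objEquiv.symm (Category.comp_id φ.unop)

end

open SSet.Truncated.HomotopyCategory

/-! ### The comparison between homotopy categories -/

section

variable {A B C : SSet.{u}} [hA : SSet.Quasicategory A] [hB : SSet.Quasicategory B]
    [hC : SSet.Quasicategory C] (f : B ⟶ A) (g : C ⟶ A)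

theorem isSmothering_hoComparison : IsSmothering (hoComparison f g) where
  surjective_obj := by
    rintro ⟨l, r, t⟩
    obtain ⟨b, rfl⟩ := l.mk_surjective
    obtain ⟨c, rfl⟩ := r.mk_surjective
    obtain ⟨e, rfl⟩ := homMk_surjective (V := (SSet.truncation 2).obj A) (x := f.app _ b)
      (y := g.app _ c) t
    obtain ⟨x, rfl, rfl, hx⟩ := (isComma_commaObj f g).exists_vertex (.ofTruncated e)
    obtain rfl : htpyEdge (commaHtpy f g) (ι₀_commaHtpy f g) (ι₁_commaHtpy f g) x = e :=
      SSet.Edge.ext hx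
    exact ⟨mk x, rfl⟩
  full := ⟨fun {x y} m ↦ by
    have := quasicategory_commaObj f g
    obtain ⟨x, rfl⟩ := x.mk_surjective
    obtain ⟨y, rfl⟩ := y.mk_surjective
    obtain ⟨l, r, w⟩ := m
    obtain ⟨u, rfl⟩ := homMk_surjective (V := (SSet.truncation 2).obj B)
      (x := (commaP₀ f g).app _ x) (y := (commaP₀ f g).app _ y) l
    obtain ⟨v, rfl⟩ := homMk_surjective (V := (SSet.truncation 2).obj C)
      (x := (commaP₁ f g).app _ x) (y := (commaP₁ f g).app _ y) r
    obtain ⟨m, hm₀, hm₁⟩ := (isComma_commaObj f g).exists_hom (.ofTruncated u) (.ofTruncated v) w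
    exact ⟨m, Comma.hom_ext _ _ hm₀ hm₁⟩⟩
  conservative := ⟨fun {x y} m hm ↦ by
    have := quasicategory_commaObj f g
    obtain ⟨x, rfl⟩ := x.mk_surjective
    obtain ⟨y, rfl⟩ := y.mk_surjective
    obtain ⟨e, rfl⟩ := homMk_surjective (V := (SSet.truncation 2).obj (commaObj f g)) m
    refine (isInvertible_edge_iff (.ofTruncated e)).1 ((isComma_commaObj f g).isInvertible ?_ ?_)
    · exact (isInvertible_edge_iff ((SSet.Edge.ofTruncated e).map (commaP₀ f g))).2
        (inferInstanceAs (IsIso ((Comma.fst _ _).map ((hoComparison f g).map (homMk e)))))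
    · exact (isInvertible_edge_iff ((SSet.Edge.ofTruncated e).map (commaP₁ f g))).2
        (inferInstanceAs (IsIso ((Comma.snd _ _).map ((hoComparison f g).map (homMk e)))))⟩

end

/-! ### Two-cells of `qCat₂` -/

namespace qCat₂

variable {X Y Z : SSet.{u}} {hX : SSet.Quasicategory X} {hY : SSet.Quasicategory Y}
  {hZ : SSet.Quasicategory Z}

lemma ofMap_surjective : Function.Surjective (ofMap (hX := hX) (hY := hY)) :=
  fun a ↦ ⟨a.hom, rfl⟩

/-- The object of `h(Y^X)` given by a map `X ⟶ Y`. -/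
abbrev hoVertex (a : X ⟶ Y) :
    ((SSet.truncation 2).obj (SimplicialCategory.sHom X Y)).HomotopyCategory :=
  mk (V := (SSet.truncation 2).obj (SimplicialCategory.sHom X Y)) (homVertex a)

/-- The 2-cell of `qCat₂` given by a morphism of `h(Y^X)`. -/
def ofHom {a b : X ⟶ Y} (t : hoVertex a ⟶ hoVertex b) :
    (ofMap a : of X hX ⟶ of Y hY) ⟶ ofMap b :=
  CatEnrichedOrdinary.Hom.mk' (C := SSet.QCat.{u})
    (X := (ObjectProperty.FullSubcategory.mk X hX : SSet.QCat.{u}))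
    (Y := (ObjectProperty.FullSubcategory.mk Y hY : SSet.QCat.{u})) t

lemma ofHom_surjective {a b : X ⟶ Y} :
    Function.Surjective (ofHom (hX := hX) (hY := hY) (a := a) (b := b)) :=
  fun t ↦ ⟨CatEnrichedOrdinary.Hom.base' t, rfl⟩

lemma ofHom_injective {a b : X ⟶ Y} :
    Function.Injective (ofHom (hX := hX) (hY := hY) (a := a) (b := b)) :=
  fun _ _ h ↦ congrArg CatEnrichedOrdinary.Hom.base' h

lemma isIso_ofHom_iff {a b : X ⟶ Y} (t : hoVertex a ⟶ hoVertex b) :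
    IsIso (ofHom (hX := hX) (hY := hY) t) ↔ IsIso t := by
  constructor
  · rintro ⟨s, h₁, h₂⟩
    obtain ⟨s, rfl⟩ := ofHom_surjective s
    exact ⟨s, ofHom_injective h₁, ofHom_injective h₂⟩
  · rintro ⟨s, h₁, h₂⟩
    exact ⟨ofHom s, congrArg ofHom h₁, congrArg ofHom h₂⟩

/-- Y^X is a quasi-category, so its homotopy category has only classes of edges as morphisms. -/
lemma exists_ofHom_homMk {a b : X ⟶ Y} (t : (ofMap a : of X hX ⟶ of Y hY) ⟶ ofMap b) :
    ∃ e : SSet.Edge (homVertex a) (homVertex b), ofHom (homMk e.toTruncated) = t := by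
  have : SSet.Quasicategory (SimplicialCategory.sHom X Y) :=
    inferInstanceAs (SSet.Quasicategory ((ihom X).obj Y))
  obtain ⟨t, rfl⟩ := ofHom_surjective t
  obtain ⟨e, rfl⟩ := homMk_surjective t
  exact ⟨.ofTruncated e, rfl⟩

/-- The image of a pair of edges under composition of simplicial homs. -/
def edgeComp {a b : X ⟶ Y} {p q : Y ⟶ Z} (e : SSet.Edge (homVertex a) (homVertex b))
    (e' : SSet.Edge (homVertex p) (homVertex q)) :
    SSet.Edge (homVertex (a ≫ p)) (homVertex (b ≫ q)) :=
  .ofTruncated ((e.toTruncated.tensor e'.toTruncated).map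
    ((SSet.truncation 2).map (SimplicialCategory.sHomComp X Y Z)))

/-- Horizontal composition is h applied to Y^X × Z^Y → Z^X, read through h of a product being the
product of the h's. -/
lemma hComp_homMk {a b : X ⟶ Y} {p q : Y ⟶ Z} (e : SSet.Edge (homVertex a) (homVertex b))
    (e' : SSet.Edge (homVertex p) (homVertex q)) :
    CatEnrichedOrdinary.hComp (C := SSet.QCat.{u})
      (ofHom (hX := hX) (hY := hY) (homMk e.toTruncated))
      (ofHom (hX := hY) (hY := hZ) (homMk e'.toTruncated)) =
      (ofHom (homMk (edgeComp e e').toTruncated) :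
        (ofMap (a ≫ p) : of X hX ⟶ of Z hZ) ⟶ ofMap (b ≫ q)) := by
  have h : CatEnriched.hComp (C := SSet.QCat.{u})
      (CatEnrichedOrdinary.Hom.base (ofHom (hX := hX) (hY := hY) (homMk e.toTruncated)))
      (CatEnrichedOrdinary.Hom.base (ofHom (hX := hY) (hY := hZ) (homMk e'.toTruncated))) =
      homMk (edgeComp e e').toTruncated :=
    congrArg (SSet.Truncated.mapHomotopyCategory ((SSet.truncation 2).map
      (SimplicialCategory.sHomComp X Y Z))).map
      (BinaryProduct.inverse_map_mkHom_homMk_homMk e.toTruncated e'.toTruncated)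
  exact congrArg ofHom ((Category.id_comp _).trans ((Category.comp_id _).trans h))

/-- Whiskering is horizontal composition with an identity, which a degenerate edge represents. -/
lemma ofHom_whiskerRight {a b : X ⟶ Y} (e : SSet.Edge (homVertex a) (homVertex b)) (p : Y ⟶ Z) :
    Bicategory.whiskerRight (ofHom (hX := hX) (homMk e.toTruncated))
        (ofMap p : of Y hY ⟶ of Z hZ) =
      ofHom (a := a ≫ p) (b := b ≫ p) (homMk (e.map ((ihom X).map p)).toTruncated) := by
  refine (congrArg (CatEnrichedOrdinary.hComp (C := SSet.QCat.{u})
    (ofHom (hX := hX) (hY := hY) (homMk e.toTruncated)))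
    (congrArg (ofHom (a := p) (b := p) (hX := hY) (hY := hZ)) (homMk_id _).symm)).trans ?_
  exact hComp_homMk e (SSet.Edge.id (homVertex p))

lemma whiskerLeft_ofHtpy (a : X ⟶ Y) {p q : Y ⟶ Z} (H : Y ⊗ Δ[1] ⟶ Z)
    (h₀ : SSet.ι₀ ≫ H = p) (h₁ : SSet.ι₁ ≫ H = q) :
    Bicategory.whiskerLeft (ofMap a : of X hX ⟶ of Y hY) (ofHtpy (hY := hZ) H h₀ h₁) =
      ofHtpy (a := a ≫ p) (b := a ≫ q) (a ▷ _ ≫ H) (by simp [h₀]) (by simp [h₁]) := by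
  refine (congrArg (fun s ↦ CatEnrichedOrdinary.hComp (C := SSet.QCat.{u}) s
    (ofHtpy (hX := hY) (hY := hZ) H h₀ h₁))
    (congrArg (ofHom (a := a) (b := a) (hX := hX) (hY := hY)) (homMk_id _).symm)).trans ?_
  exact hComp_homMk (SSet.Edge.id (homVertex a)) (htpySimplexEdge H h₀ h₁)

end qCat₂

/-! ### The weak universal property -/

section

open qCat₂

variable {A B C K : SSet.{u}} (f : B ⟶ A) (g : C ⟶ A)

/-- The edge of `Aᴷ` associated with a map `a : K ⟶ f ↓ g`. -/
def commaEdge (a : K ⟶ commaObj f g) :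
    SSet.Edge (homVertex (a ≫ commaP₀ f g ≫ f)) (homVertex (a ≫ commaP₁ f g ≫ g)) :=
  htpySimplexEdge (a ▷ _ ≫ commaHtpy f g) (by simp [ι₀_commaHtpy]) (by simp [ι₁_commaHtpy])

lemma htpyEdge_powHtpy (a : K ⟶ commaObj f g) :
    htpyEdge (powHtpy K (commaHtpy f g)) ((isComma_commaObj f g).pow K).ι₀_comp
      ((isComma_commaObj f g).pow K).ι₁_comp (homVertex a) = commaEdge f g a :=
  SSet.Edge.ext (arrowOf_powHtpy _ a)

variable {hA : SSet.Quasicategory A} {hB : SSet.Quasicategory B}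
    {hC : SSet.Quasicategory C} {hP : SSet.Quasicategory (commaObj f g)}
    {hK : SSet.Quasicategory K}

/-- The associators are identities, leaving only the whiskered 2-cell. -/
lemma comparison_obj_hom (a : K ⟶ commaObj f g) :
    (((commaCone f g hA hB hC hP).comparison (of K hK)).obj (ofMap a)).hom =
      ofHom (a := a ≫ commaP₀ f g ≫ f) (b := a ≫ commaP₁ f g ≫ g)
        (homMk (commaEdge f g a).toTruncated) :=
  (Category.id_comp _).trans ((Category.comp_id _).trans (whiskerLeft_ofHtpy _ _ _ _))

theorem isSmothering_comparison :
    IsSmothering ((commaCone f g hA hB hC hP).comparison (of K hK)) where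
  surjective_obj := by
    rintro ⟨b, c, t⟩
    obtain ⟨b, rfl⟩ := ofMap_surjective b
    obtain ⟨c, rfl⟩ := ofMap_surjective c
    obtain ⟨e, rfl⟩ := exists_ofHom_homMk (a := b ≫ f) (b := c ≫ g) t
    obtain ⟨x, h₀, h₁, hx⟩ := ((isComma_commaObj f g).pow K).exists_vertex (b := homVertex b)
      (c := homVertex c) e
    obtain ⟨a, rfl⟩ := (SimplicialCategory.homEquiv' K (commaObj f g)).surjective x
    obtain rfl : a ≫ commaP₀ f g = b := (SimplicialCategory.homEquiv' K B).injective h₀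
    obtain rfl : a ≫ commaP₁ f g = c := (SimplicialCategory.homEquiv' K C).injective h₁
    obtain rfl : commaEdge f g a = e := SSet.Edge.ext ((arrowOf_powHtpy _ a).symm.trans hx)
    exact ⟨ofMap a, congrArg (fun t ↦ Comma.mk
      (L := Bicategory.postcomp (of K hK) (ofMap f : of B hB ⟶ of A hA))
      (R := Bicategory.postcomp (of K hK) (ofMap g : of C hC ⟶ of A hA))
      (ofMap (a ≫ commaP₀ f g)) (ofMap (a ≫ commaP₁ f g)) t) (comparison_obj_hom f g a)⟩
  full := ⟨fun {x y} m ↦ by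
    obtain ⟨x, rfl⟩ := ofMap_surjective x
    obtain ⟨y, rfl⟩ := ofMap_surjective y
    obtain ⟨l, r, w⟩ := m
    obtain ⟨u, rfl⟩ := exists_ofHom_homMk (a := x ≫ commaP₀ f g) (b := y ≫ commaP₀ f g) l
    obtain ⟨v, rfl⟩ := exists_ofHom_homMk (a := x ≫ commaP₁ f g) (b := y ≫ commaP₁ f g) r
    obtain ⟨m, hm₀, hm₁⟩ := ((isComma_commaObj f g).pow K).exists_hom
      (x := homVertex x) (y := homVertex y) u v (by
        -- The compatibility `w` of 2-cells becomes the commuting square in h(Aᴷ) that `exists_hom`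
        -- needs.
        rw [htpyEdge_powHtpy, htpyEdge_powHtpy]
        refine ofHom_injective (hX := hK) (hY := hA) (a := x ≫ commaP₀ f g ≫ f)
          (b := y ≫ commaP₁ f g ≫ g) ?_
        refine (congrArg₂ (· ≫ ·) (ofHom_whiskerRight u f).symm
          (comparison_obj_hom f g y).symm).trans (w.trans ?_)
        exact congrArg₂ (· ≫ ·) (comparison_obj_hom f g x) (ofHom_whiskerRight v g))
    obtain ⟨e, rfl⟩ := homMk_surjective m
    exact ⟨ofHom (homMk e), Comma.hom_ext _ _
      ((ofHom_whiskerRight e (commaP₀ f g)).trans (congrArg ofHom hm₀))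
      ((ofHom_whiskerRight e (commaP₁ f g)).trans (congrArg ofHom hm₁))⟩⟩
  conservative := ⟨fun {x y} m hm ↦ by
    obtain ⟨x, rfl⟩ := ofMap_surjective x
    obtain ⟨y, rfl⟩ := ofMap_surjective y
    obtain ⟨e, rfl⟩ := exists_ofHom_homMk m
    rw [isIso_ofHom_iff, ← isInvertible_edge_iff]
    refine ((isComma_commaObj f g).pow K).isInvertible ?_ ?_
    · refine (isInvertible_edge_iff (e.map ((ihom K).map (commaP₀ f g)))).2 ?_
      refine (isIso_ofHom_iff (hX := hK) (hY := hB) (a := x ≫ commaP₀ f g)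
        (b := y ≫ commaP₀ f g) _).1 ?_
      refine (congrArg IsIso (ofHom_whiskerRight (hY := hP) e (commaP₀ f g))).mp ?_
      exact inferInstanceAs (IsIso ((Comma.fst _ _).map
        (((commaCone f g hA hB hC hP).comparison (of K hK)).map _)))
    · refine (isInvertible_edge_iff (e.map ((ihom K).map (commaP₁ f g)))).2 ?_
      refine (isIso_ofHom_iff (hX := hK) (hY := hC) (a := x ≫ commaP₁ f g)
        (b := y ≫ commaP₁ f g) _).1 ?_
      refine (congrArg IsIso (ofHom_whiskerRight (hY := hP) e (commaP₁ f g))).mp ?_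
      exact inferInstanceAs (IsIso ((Comma.snd _ _).map
        (((commaCone f g hA hB hC hP).comparison (of K hK)).map _)))⟩

end

end WeakComma

theorem mainTheorem3 {A B C : SSet.{u}} [hA : SSet.Quasicategory A] [hB : SSet.Quasicategory B]
    [hC : SSet.Quasicategory C] (f : B ⟶ A) (g : C ⟶ A) :
    ∃ hP : SSet.Quasicategory (WeakComma.commaObj f g),
      (WeakComma.commaCone f g hA hB hC hP).IsWeakComma ∧
      WeakComma.IsSmothering (WeakComma.hoComparison f g) :=
  ⟨WeakComma.quasicategory_commaObj f g, fun K ↦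
    WeakComma.isSmothering_comparison f g (K := K.obj) (hK := K.property),
    WeakComma.isSmothering_hoComparison f g⟩

end
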